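/- Let $N\ge 3$ be an integer and let $q$ be a positive real number, $q\ne1$. Repeated upper and lower indices are summed from $1$ to $N$; $i':=N+1-i$; $(i=j)$ and $(i<j)$ equal $1$ if the stated relation holds and $0$ otherwise. Put $\varrho_i=\frac N2-i$ for $i<\frac{N+1}2$, $\varrho_i=0$ for $i=\frac{N+1}2$, $\varrho_i=\frac N2-i+1$ for $i>\frac{N+1}2$, and $$C^{ij}=C_{ij}=q^{-\varrho_i}(i=j'),\qquad K^{kl}_{ij}=C^{ij}C_{kl},$$ $$\hat R^{kl}_{ij}=q^{(k=l)-(k=l')}(i=l)(j=k)+(q-q^{-1})(i<l)\bigl((i=k)(j=l)-K^{kl}_{ij}\bigr),$$ $$(\hat R^{-1})^{kl}_{ij}=\hat R^{kl}_{ij}-(q-q^{-1})(i=k)(j=l)+(q-q^{-1})K^{kl}_{ij}.$$ Let $X$ be the complex algebra with generators $x_1,\dots,x_N$ and relations $$(\hat R^{-1})^{kl}_{ij}x_kx_l=q^{-1}x_ix_j+\frac{q^{N-1}-q^{N-3}}{1+q^{N-2}}K^{kl}_{ij}x_kx_l,\qquad C^{kl}x_kx_l=1$$ (the quantum Euclidean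 sphere). Let $\Gamma_+$ and $\Gamma_-$ be the first order differential calculi over $X$ determined by the bimodule relations $$\mathrm dx_i\cdot x_j=\pm(\hat R^{-1})^{kl}_{ij}x_k\,\mathrm dx_l+(\pm q-1)x_i\,\mathrm dx_j+\frac{q^N-q^{N-2}}{1\mp q^{N-1}}K^{kl}_{ij}x_k\,\mathrm dx_l+\frac{(1\mp q)(1+q^{N-2})}{1\mp q^{N-1}}C^{kl}x_ix_jx_k\,\mathrm dx_l,$$ i.e. the quotients of the universal first order differential calculus of $X$ by the sub-bimodules generated by these relations; here and below the upper signs refer to $\Gamma_+$ and the lower signs to $\Gamma_-$. Put $\eta:=C^{kl}x_k\,\mathrm dx_l$. Let $\Gamma$ be one of $\Gamma_+$ and $\Gamma_-$. Then there are exactly two real numbers $\alpha$ for which the one-forms $\gamma_i:=\mathrm dx_i+\alpha x_i\eta$, $i=1,\dots,N$, form a basis of $\Gamma$ as a left $X$-module and satisfy $$\gamma_ix_j=A^{kl}_{ij}x_k\gamma_l\qquad(1\le i,j\le N)$$ with some real coefficients $A^{kl}_{ij}$. These two (distinct) values are $$\alpha^+=-\frac{1+q^{N-2}}{1\mp q^{N-1}},\qquad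 \alpha^-=\pm q\,\frac{1+q^{N-2}}{1\mp q^{N-1}}.$$ With respect to the two bases $\gamma^+_i:=\mathrm dx_i+\alpha^+x_i\eta$ and $\gamma^-_i:=\mathrm dx_i+\alpha^-x_i\eta$ one has $$\gamma^+_ix_j=\pm\hat R^{kl}_{ij}x_k\gamma^+_l,\qquad \gamma^-_ix_j=\pm(\hat R^{-1})^{kl}_{ij}x_k\gamma^-_l .$$ -/

import Mathlib

open scoped TensorProduct RightActions

namespace QuantumSphere

noncomputable section

/-! ### First order differential calculi given by relations

For a complex algebra `A`, an `A`-bimodule (with equal left and right actions of `ℂ`) is a module over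
the enveloping algebra `A ⊗ Aᵒᵖ`. The universal first order differential calculus is the left ideal of
`A ⊗ Aᵒᵖ` generated by the elements `d a = 1 ⊗ a - a ⊗ 1` (the kernel of the multiplication
`A ⊗ A → A`). Every first order differential calculus is a quotient of it by a sub-bimodule. -/

/-- The enveloping algebra `A ⊗ Aᵒᵖ`. -/
def Env (A : Type*) [Ring A] [Algebra ℂ A] : Type _ := A ⊗[ℂ] Aᵐᵒᵖ

section Env

variable {A : Type*} [Ring A] [Algebra ℂ A]

instance : Ring (Env A) := inferInstanceAs (Ring (A ⊗[ℂ] Aᵐᵒᵖ))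

instance : Algebra ℂ (Env A) := inferInstanceAs (Algebra ℂ (A ⊗[ℂ] Aᵐᵒᵖ))

/-- The embedding `a ↦ a ⊗ 1`. -/
def left : A →ₐ[ℂ] Env A :=
  (Algebra.TensorProduct.includeLeft : A →ₐ[ℂ] A ⊗[ℂ] Aᵐᵒᵖ)

/-- The embedding `b ↦ 1 ⊗ b` of the opposite algebra. -/
def right : Aᵐᵒᵖ →ₐ[ℂ] Env A :=
  (Algebra.TensorProduct.includeRight : Aᵐᵒᵖ →ₐ[ℂ] A ⊗[ℂ] Aᵐᵒᵖ)

theorem left_mul_right (a : A) (b : Aᵐᵒᵖ) : left a * right b = right b * left a := by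
  change (a ⊗ₜ[ℂ] (1 : Aᵐᵒᵖ)) * ((1 : A) ⊗ₜ[ℂ] b) = ((1 : A) ⊗ₜ[ℂ] b) * (a ⊗ₜ[ℂ] (1 : Aᵐᵒᵖ))
  simp only [Algebra.TensorProduct.tmul_mul_tmul, one_mul, mul_one]

theorem Env.induction {P : Env A → Prop} (zero : P 0)
    (mul : ∀ a b, P (left a * right b)) (add : ∀ x y, P x → P y → P (x + y)) (e : Env A) : P e := by
  refine TensorProduct.induction_on (motive := P) e zero (fun a b => ?_) add
  have h : (a ⊗ₜ[ℂ] b : A ⊗[ℂ] Aᵐᵒᵖ) = (a ⊗ₜ[ℂ] (1 : Aᵐᵒᵖ)) * ((1 : A) ⊗ₜ[ℂ] b) := by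
    simp only [Algebra.TensorProduct.tmul_mul_tmul, one_mul, mul_one]
  rw [h]
  exact mul a b

/-- The element `1 ⊗ a - a ⊗ 1`. -/
def preD (a : A) : Env A := right (MulOpposite.op a) - left a

end Env

/-- The universal bimodule of one-forms, as a left ideal of the enveloping algebra. -/
def univForms (A : Type*) [Ring A] [Algebra ℂ A] : Submodule (Env A) (Env A) :=
  Submodule.span (Env A) (Set.range preD)

/-- The universal differentiation map, as a function. -/
def univD {A : Type*} [Ring A] [Algebra ℂ A] (a : A) : univForms A :=
  ⟨preD a, Submodule.subset_span ⟨a, rfl⟩⟩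

/-- The quotient of the universal bimodule of one-forms over `A` by the sub-bimodule generated by a
set `S` of relations (for `S = ∅` this is the universal bimodule of one-forms itself). -/
def Forms (A : Type*) [Ring A] [Algebra ℂ A] (S : Set (univForms A)) : Type _ :=
  univForms A ⧸ Submodule.span (Env A) S

section Forms

variable {A : Type*} [Ring A] [Algebra ℂ A] (S : Set (univForms A))

instance : AddCommGroup (Forms A S) :=
  inferInstanceAs (AddCommGroup (univForms A ⧸ Submodule.span (Env A) S))

instance : Module (Env A) (Forms A S) :=
  inferInstanceAs (Module (Env A) (univForms A ⧸ Submodule.span (Env A) S))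

/-- The left action, `a • ω = (a ⊗ 1) • ω`. -/
instance : Module A (Forms A S) := Module.compHom _ (left : A →ₐ[ℂ] Env A).toRingHom

/-- The right action, `ω <• a = (1 ⊗ a) • ω`. -/
instance : Module Aᵐᵒᵖ (Forms A S) := Module.compHom _ (right : Aᵐᵒᵖ →ₐ[ℂ] Env A).toRingHom

instance : Module ℂ (Forms A S) := Module.compHom _ (algebraMap ℂ (Env A))

theorem left_smul_def (a : A) (ω : Forms A S) : a • ω = left a • ω := rfl

theorem right_smul_def (b : Aᵐᵒᵖ) (ω : Forms A S) : b • ω = right b • ω := rfl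

theorem complex_smul_def (c : ℂ) (ω : Forms A S) : c • ω = algebraMap ℂ (Env A) c • ω := rfl

instance : SMulCommClass A Aᵐᵒᵖ (Forms A S) where
  smul_comm a b ω := by
    simp only [left_smul_def, right_smul_def, ← mul_smul, left_mul_right]

instance : IsScalarTower ℂ A (Forms A S) where
  smul_assoc c a ω := by
    rw [left_smul_def, left_smul_def, complex_smul_def, ← mul_smul, ← Algebra.smul_def, map_smul]

instance : IsScalarTower ℂ Aᵐᵒᵖ (Forms A S) where
  smul_assoc c b ω := by
    rw [right_smul_def, right_smul_def, complex_smul_def, ← mul_smul, ← Algebra.smul_def, map_smul]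

/-- The projection from the universal bimodule of one-forms. -/
def proj : univForms A →ₗ[Env A] Forms A S := (Submodule.span (Env A) S).mkQ

theorem proj_surjective : Function.Surjective (proj S) := Submodule.mkQ_surjective _

/-- The differentiation map of the calculus with the relations `S`. -/
def d : A →ₗ[ℂ] Forms A S where
  toFun a := proj S (univD a)
  map_add' a b := by
    rw [← map_add]
    congr 1
    apply Subtype.ext
    simp only [univD, preD, Submodule.coe_add, MulOpposite.op_add, map_add]
    abel
  map_smul' c a := by
    rw [RingHom.id_apply, complex_smul_def, ← map_smul]
    congr 1
    apply Subtype.ext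
    simp only [univD, preD, Submodule.coe_smul, MulOpposite.op_smul, map_smul, smul_eq_mul,
      ← Algebra.smul_def, smul_sub]

/-- The Leibniz rule. -/
theorem d_mul (a b : A) : d S (a * b) = d S a <• b + a • d S b := by
  rw [left_smul_def, right_smul_def]
  change proj S _ = _ • proj S _ + _ • proj S _
  rw [← map_smul, ← map_smul, ← map_add]
  congr 1
  apply Subtype.ext
  simp only [univD, preD, Submodule.coe_add, Submodule.coe_smul, smul_eq_mul, mul_sub,
    MulOpposite.op_mul, map_mul, left_mul_right]
  abel

/-- The exact one-forms generate all one-forms as a left module. -/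
theorem span_range_d : Submodule.span A (Set.range (d S)) = ⊤ := by
  have key : ∀ (e : Env A) (ω : Forms A S), ω ∈ Submodule.span A (Set.range (d S)) →
      e • ω ∈ Submodule.span A (Set.range (d S)) := by
    intro e ω hω
    induction e using Env.induction with
    | zero => rw [zero_smul]; exact zero_mem _
    | add x y hx hy => rw [add_smul]; exact add_mem hx hy
    | mul a b =>
      rw [mul_smul, ← right_smul_def, ← left_smul_def]
      refine Submodule.smul_mem _ _ ?_
      induction hω using Submodule.span_induction with
      | zero => rw [smul_zero]; exact zero_mem _
      | add x y _ _ hx hy => rw [smul_add]; exact add_mem hx hy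
      | smul c x _ hx => rw [← smul_comm]; exact Submodule.smul_mem _ _ hx
      | mem x hx =>
        obtain ⟨c, rfl⟩ := hx
        have h := eq_sub_of_add_eq (d_mul S c b.unop).symm
        rw [MulOpposite.op_unop] at h
        rw [h]
        exact sub_mem (Submodule.subset_span ⟨_, rfl⟩)
          (Submodule.smul_mem _ _ (Submodule.subset_span ⟨_, rfl⟩))
  rw [eq_top_iff]
  rintro ω -
  obtain ⟨⟨w, hw⟩, rfl⟩ := proj_surjective S ω
  induction hw using Submodule.span_induction with
  | zero => exact zero_mem _
  | add x y hx hy h1 h2 => exact add_mem h1 h2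
  | smul e x hx h => exact key e _ h
  | mem x hx =>
    obtain ⟨a, rfl⟩ := hx
    exact Submodule.subset_span ⟨a, rfl⟩

end Forms

/-! ### The structure constants of `O_q(N)`

Indices run over `Fin N`, so that `i : Fin N` stands for the index `i + 1` of `{1, …, N}`, and
`i.rev` stands for `i' = N + 1 - i`. -/

/-- The numbers `ϱ_i`. -/
def rho {N : ℕ} (i : Fin N) : ℝ :=
  if 2 * ((i : ℕ) + 1) < N + 1 then (N : ℝ) / 2 - ((i : ℕ) + 1)
  else if 2 * ((i : ℕ) + 1) = N + 1 then 0
  else (N : ℝ) / 2 - ((i : ℕ) + 1) + 1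

/-- The matrix `C^{ij} = C_{ij} = q^{-ϱ_i} (i = j')`. -/
def C (q : ℝ) {N : ℕ} (i j : Fin N) : ℝ := if i = j.rev then q ^ (-rho i) else 0

/-- `K q k l i j` is `K^{kl}_{ij} = C^{ij} C_{kl}`. -/
def K (q : ℝ) {N : ℕ} (k l i j : Fin N) : ℝ := C q i j * C q k l

/-- `R q k l i j` is the R-matrix entry `R̂^{kl}_{ij}`. -/
def R (q : ℝ) {N : ℕ} (k l i j : Fin N) : ℝ :=
  q ^ ((if k = l then 1 else 0) - (if k = l.rev then 1 else 0) : ℤ) *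
      (if i = l then 1 else 0) * (if j = k then 1 else 0) +
    (q - q⁻¹) * (if i < l then 1 else 0) *
      ((if i = k then 1 else 0) * (if j = l then 1 else 0) - K q k l i j)

/-- `Rinv q k l i j` is the entry `(R̂⁻¹)^{kl}_{ij}` of
`R̂⁻¹ = R̂ - (q - q⁻¹) I + (q - q⁻¹) K`. -/
def Rinv (q : ℝ) {N : ℕ} (k l i j : Fin N) : ℝ :=
  R q k l i j - (q - q⁻¹) * ((if i = k then 1 else 0) * (if j = l then 1 else 0)) +
    (q - q⁻¹) * K q k l i j

/-! ### The quantum Euclidean sphere -/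

/-- The free generators. -/
abbrev genX {N : ℕ} (i : Fin N) : FreeAlgebra ℂ (Fin N) := FreeAlgebra.ι ℂ i

/-- The defining relations of the quantum Euclidean sphere. -/
inductive SphereRel (q : ℝ) (N : ℕ) : FreeAlgebra ℂ (Fin N) → FreeAlgebra ℂ (Fin N) → Prop
  | comm (i j : Fin N) : SphereRel q N
      (∑ k, ∑ l, (Rinv q k l i j : ℂ) • (genX k * genX l))
      (((q⁻¹ : ℝ) : ℂ) • (genX i * genX j) +
        (((q ^ ((N : ℤ) - 1) - q ^ ((N : ℤ) - 3)) / (1 + q ^ ((N : ℤ) - 2)) : ℝ) : ℂ) •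
          ∑ k, ∑ l, (K q k l i j : ℂ) • (genX k * genX l))
  | radius : SphereRel q N (∑ k, ∑ l, (C q k l : ℂ) • (genX k * genX l)) 1

/-- The coordinate algebra of the quantum Euclidean sphere of dimension `N - 1`. -/
abbrev Sphere (q : ℝ) (N : ℕ) : Type := RingQuot (SphereRel q N)

/-- The generators `x_i`. -/
def x (q : ℝ) {N : ℕ} (i : Fin N) : Sphere q N := RingQuot.mkAlgHom ℂ (SphereRel q N) (genX i)

/-! ### The two calculi `Γ₊` and `Γ₋`

The sign `ε` is `1` for `Γ₊` and `-1` for `Γ₋`. -/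

/-- The one-form `a · d b` of the universal calculus. -/
def lmulD {A : Type*} [Ring A] [Algebra ℂ A] (a b : A) : univForms A := left a • univD b

/-- The one-form `d a · b` of the universal calculus. -/
def rmulD {A : Type*} [Ring A] [Algebra ℂ A] (a b : A) : univForms A :=
  right (MulOpposite.op b) • univD a

/-- The expression which `dx_i · x_j` equals in `Γ_±`, formed in the universal calculus. -/
def bimoduleRHS (ε q : ℝ) {N : ℕ} (i j : Fin N) : univForms (Sphere q N) :=
  (∑ k, ∑ l, lmulD (((ε * Rinv q k l i j : ℝ) : ℂ) • x q k) (x q l)) +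
    lmulD (((ε * q - 1 : ℝ) : ℂ) • x q i) (x q j) +
    (∑ k, ∑ l, lmulD ((((q ^ (N : ℤ) - q ^ ((N : ℤ) - 2)) / (1 - ε * q ^ ((N : ℤ) - 1)) *
      K q k l i j : ℝ) : ℂ) • x q k) (x q l)) +
    ∑ k, ∑ l, lmulD ((((1 - ε * q) * (1 + q ^ ((N : ℤ) - 2)) / (1 - ε * q ^ ((N : ℤ) - 1)) *
      C q k l : ℝ) : ℂ) • (x q i * x q j * x q k)) (x q l)

/-- The bimodule relations of `Γ_±`. -/
def relations (ε q : ℝ) (N : ℕ) : Set (univForms (Sphere q N)) :=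
  Set.range fun p : Fin N × Fin N => rmulD (x q p.1) (x q p.2) - bimoduleRHS ε q p.1 p.2

/-- The bimodule of one-forms of `Γ₊` (`ε = 1`) and `Γ₋` (`ε = -1`): the first order differential
calculus over the quantum Euclidean sphere with the relations expressing `dx_i · x_j` through left
multiples of the `dx_l`. -/
abbrev Gam (ε q : ℝ) (N : ℕ) : Type := Forms (Sphere q N) (relations ε q N)

/-- The one-form `dx_i`. -/
def dx (ε q : ℝ) {N : ℕ} (i : Fin N) : Gam ε q N := d (relations ε q N) (x q i)

/-- The bimodule relations hold in `Γ_±`. -/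
theorem dx_mul_x (ε q : ℝ) {N : ℕ} (i j : Fin N) :
    dx ε q i <• x q j =
      (∑ k, ∑ l, (((ε * Rinv q k l i j : ℝ) : ℂ) • x q k) • dx ε q l) +
      (((ε * q - 1 : ℝ) : ℂ) • x q i) • dx ε q j +
      (∑ k, ∑ l, ((((q ^ (N : ℤ) - q ^ ((N : ℤ) - 2)) / (1 - ε * q ^ ((N : ℤ) - 1)) *
        K q k l i j : ℝ) : ℂ) • x q k) • dx ε q l) +
      ∑ k, ∑ l, ((((1 - ε * q) * (1 + q ^ ((N : ℤ) - 2)) / (1 - ε * q ^ ((N : ℤ) - 1)) *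
        C q k l : ℝ) : ℂ) • (x q i * x q j * x q k)) • dx ε q l := by
  have h : proj (relations ε q N) (rmulD (x q i) (x q j)) =
      proj (relations ε q N) (bimoduleRHS ε q i j) :=
    (Submodule.Quotient.eq _).2 (Submodule.subset_span ⟨(i, j), rfl⟩)
  simp only [bimoduleRHS, rmulD, lmulD, map_add, map_sum, map_smul (proj _)] at h
  exact h

/-- The invariant one-form `η = C^{kl} x_k dx_l`. -/
def eta (ε q : ℝ) (N : ℕ) : Gam ε q N := ∑ k, ∑ l, ((C q k l : ℂ) • x q k) • dx ε q l

/-- The one-forms `γ_i = dx_i + α x_i η`. -/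
def gam (ε q α : ℝ) {N : ℕ} (i : Fin N) : Gam ε q N :=
  dx ε q i + ((α : ℂ) • x q i) • eta ε q N

/-- The family `g` is a basis of `Γ_±` as a left module over the quantum Euclidean sphere. -/
def IsLeftBasis {ε q : ℝ} {N : ℕ} (g : Fin N → Gam ε q N) : Prop :=
  LinearIndependent (Sphere q N) g ∧ Submodule.span (Sphere q N) (Set.range g) = ⊤

/-- The bimodule relations `g_i x_j = A^{kl}_{ij} x_k g_l`, where `A k l i j` is `A^{kl}_{ij}`. -/
def LinearRelations {ε q : ℝ} {N : ℕ} (g : Fin N → Gam ε q N)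
    (A : Fin N → Fin N → Fin N → Fin N → ℝ) : Prop :=
  ∀ i j, g i <• x q j = ∑ k, ∑ l, ((A k l i j : ℂ) • x q k) • g l

/-- The value `α⁺`. -/
def alphaPlus (ε q : ℝ) (N : ℕ) : ℝ := -((1 + q ^ ((N : ℤ) - 2)) / (1 - ε * q ^ ((N : ℤ) - 1)))

/-- The value `α⁻`. -/
def alphaMinus (ε q : ℝ) (N : ℕ) : ℝ :=
  ε * q * ((1 + q ^ ((N : ℤ) - 2)) / (1 - ε * q ^ ((N : ℤ) - 1)))

end

end QuantumSphere

/-!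
The whole computation is expressed by two operations on functions `G` of two indices with values in
a complex vector space: `Rop q G`, the action of the matrix `R̂`, and `Ct q G`, the contraction with
the metric `C`. Functions of three indices are treated by applying them to two of the indices, and
the identities needed are the quadratic relation `Rop_Rop`, the rotation of `R̂` by the metric
(`Ct_Rop_rotate`, `Rop_C_rotate`), its consequences that a contracted pair of indices slides through
a third one, and the Yang-Baxter equation `yang_baxter`. Those that do not follow from others are
proved by induction in steps of two: if the first and the last index of `Fin (N + 2)` are split
off, then `R̂` and `C` for `N + 2` are those for `N` plus a few explicit terms.

*The relations.* Contracting the bimodule relations of `Γ_±` with `C^{ki} x_k` and rotating `R̂`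
shows that `η x_j` is a combination of `x_j η` and `dx_j` (`eta_smul`). Hence `γ_i x_j` is a
combination of `R̂^{kl}_{ij} x_k dx_l`, `x_i dx_j`, `C_{ij} η` and `x_i x_j η` (`gam_smul`), and so
are `R̂^{kl}_{ij} x_k γ_l` and `(R̂⁻¹)^{kl}_{ij} x_k γ_l`. For `α⁺` and `α⁻` the coefficients agree.

*The bases.* Every `dx_i` lies in the span of the `γ_i` as soon as `1 + α ≠ 0`, because
`C^{kl} x_k γ_l = (1 + α) η`. For the linear independence the calculus has to be realized in a free
module. On the free left module with basis `e_i` let `e_i x_j = ± R̂^{kl}_{ij} x_k e_l`, the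
relation expected of `γ⁺_i`. By the Yang-Baxter equation this is compatible with the relations of
the sphere. Solving `e_i = dx_i + α⁺ x_i η` for `dx_i` gives candidates `dModel` for the
differentials of the generators. That they extend to a derivation amounts to the statement that the operators
`(a, v) ↦ (a x_j, a dx_j + v x_j)` on pairs of a function and a one-form satisfy the relations of
the sphere (`isPoint_pairMul`). Then the pairs are a bimodule, the action on the pair `(1, 0)` maps
the universal one-forms to pairs with first component `0`, and the bimodule relations are mapped to
`0`. This gives a left linear map from `Γ_±` with `γ_i ↦ e_i + (α - α⁺) x_i η` (`exists_toPairs`,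
`toPairs_gam`). The images are independent: the functional `e_i ↦ x_i` applied to `∑ a_i γ_i = 0`
gives `∑ a_i x_i = 0`, so that the terms with `η` cancel.

*Uniqueness.* If `γ_1 x_1 = A^{kl}_{11} x_k γ_l`, then the images in the free module satisfy this
relation. For every `t ≠ 0` the sphere has a character with `x_1 ↦ t`, `x_N ↦ u t⁻¹` for a fixed
number `u`, and `x_i ↦ 0` otherwise (`isPoint_torusPoint`). Applied to the last and to the first
coordinate of the relation, these characters give identities of Laurent polynomials in `t`. If
`α ≠ α⁺`, the highest coefficient of the first one determines `A^{11}_{11}`, and that of the second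
one then determines `α` (`eq_of_linearRelations`).
-/

namespace QuantumSphere

noncomputable section

/-! ### The operators of the R-matrix and of the metric -/

section operators

variable {V W : Type*} [AddCommGroup V] [Module ℂ V] [AddCommGroup W] [Module ℂ W]

/-- The number `λ = q - q⁻¹`. -/
def lam (q : ℝ) : ℝ := q - q⁻¹

/-- The action of `R̂` on functions of two indices: `(i, j) ↦ R̂^{kl}_{ij} G_{kl}`. -/
def Rop (q : ℝ) {N : ℕ} (G : Fin N → Fin N → V) (i j : Fin N) : V :=
  ∑ k, ∑ l, (R q k l i j : ℂ) • G k l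

/-- The action of `R̂⁻¹` on functions of two indices: `(i, j) ↦ (R̂⁻¹)^{kl}_{ij} G_{kl}`. -/
def Riop (q : ℝ) {N : ℕ} (G : Fin N → Fin N → V) (i j : Fin N) : V :=
  ∑ k, ∑ l, (Rinv q k l i j : ℂ) • G k l

/-- The contraction `C^{kl} G_{kl}` with the metric. -/
def Ct (q : ℝ) {N : ℕ} (G : Fin N → Fin N → V) : V :=
  ∑ k, ∑ l, (C q k l : ℂ) • G k l

section lin
variable (q : ℝ) {N : ℕ} (G H : Fin N → Fin N → V)

theorem Rop_add (i j : Fin N) :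
    Rop q (fun k l => G k l + H k l) i j = Rop q G i j + Rop q H i j := by
  simp only [Rop, smul_add, Finset.sum_add_distrib]

theorem Rop_sub (i j : Fin N) :
    Rop q (fun k l => G k l - H k l) i j = Rop q G i j - Rop q H i j := by
  simp only [Rop, smul_sub, Finset.sum_sub_distrib]

theorem Rop_smul (c : ℂ) (i j : Fin N) :
    Rop q (fun k l => c • G k l) i j = c • Rop q G i j := by
  simp only [Rop, Finset.smul_sum, smul_comm c]

theorem Ct_add : Ct q (fun k l => G k l + H k l) = Ct q G + Ct q H := by
  simp only [Ct, smul_add, Finset.sum_add_distrib]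

theorem Ct_sub : Ct q (fun k l => G k l - H k l) = Ct q G - Ct q H := by
  simp only [Ct, smul_sub, Finset.sum_sub_distrib]

theorem Ct_smul (c : ℂ) : Ct q (fun k l => c • G k l) = c • Ct q G := by
  simp only [Ct, Finset.smul_sum, smul_comm c]

theorem map_Rop (f : V →ₗ[ℂ] W) (i j : Fin N) :
    f (Rop q G i j) = Rop q (fun k l => f (G k l)) i j := by
  simp only [Rop, map_sum, map_smul]

theorem map_Ct (f : V →ₗ[ℂ] W) : f (Ct q G) = Ct q (fun k l => f (G k l)) := by
  simp only [Ct, map_sum, map_smul]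

theorem Riop_eq (i j : Fin N) :
    Riop q G i j = Rop q G i j - (lam q : ℂ) • G i j + ((lam q : ℂ) * (C q i j : ℂ)) • Ct q G := by
  have h1 : (lam q : ℂ) • G i j = ∑ k, ∑ l, (((lam q) *
      ((if i = k then 1 else 0) * (if j = l then 1 else 0)) : ℝ) : ℂ) • G k l := by
    rw [Finset.sum_eq_single i, Finset.sum_eq_single j]
    · simp
    · intro l _ hl; simp [hl.symm]
    · simp
    · intro k _ hk; simp [hk.symm]
    · simp
  rw [h1, Riop, Rop, Ct, Finset.smul_sum, ← Finset.sum_sub_distrib, ← Finset.sum_add_distrib]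
  refine Finset.sum_congr rfl fun k _ => ?_
  rw [Finset.smul_sum, ← Finset.sum_sub_distrib, ← Finset.sum_add_distrib]
  refine Finset.sum_congr rfl fun l _ => ?_
  simp only [Rinv, K, lam, smul_smul, ← add_smul, ← sub_smul]
  push_cast
  congr 1
  ring

/-- The formula from which the rows of `R̂` are computed: the products of Kronecker deltas leave one
summand each, and `K` leaves a partial contraction. -/
theorem Rop_apply (i j : Fin N) :
    Rop q G i j = (q ^ ((if i = j then 1 else 0) - (if i = j.rev then 1 else 0) : ℤ) : ℂ) • G j i +
      (if i < j then (lam q : ℂ) else 0) • G i j -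
      ((lam q : ℂ) * (C q i j : ℂ)) •
        ∑ k, ∑ l, (if i < l then (C q k l : ℂ) else 0) • G k l := by
  have h1 : (q ^ ((if i = j then 1 else 0) - (if i = j.rev then 1 else 0) : ℤ) : ℂ) • G j i
      = ∑ k, ∑ l, ((q ^ ((if k = l then 1 else 0) - (if k = l.rev then 1 else 0) : ℤ) *
      (if i = l then 1 else 0) * (if j = k then 1 else 0) : ℝ) : ℂ) • G k l := by
    rw [Finset.sum_eq_single j, Finset.sum_eq_single i]
    · have e1 : (j = i) = (i = j) := propext eq_comm
      have e2 : (j = i.rev) = (i = j.rev) := propext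
        ⟨fun h => by rw [h, Fin.rev_rev], fun h => by rw [h, Fin.rev_rev]⟩
      simp [e1, e2]
    · intro l _ hl; simp [hl.symm]
    · simp
    · intro k _ hk; simp [hk.symm]
    · simp
  have h2 : (if i < j then (lam q : ℂ) else 0) • G i j = ∑ k, ∑ l, (((lam q) *
      (if i < l then 1 else 0) * ((if i = k then 1 else 0) * (if j = l then 1 else 0)) : ℝ) : ℂ)
        • G k l := by
    rw [Finset.sum_eq_single i, Finset.sum_eq_single j]
    · by_cases h : i < j <;> simp [h]
    · intro l _ hl; simp [hl.symm]
    · simp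
    · intro k _ hk; simp [hk.symm]
    · simp
  rw [h1, h2, Rop, Finset.smul_sum, ← Finset.sum_add_distrib, ← Finset.sum_sub_distrib]
  refine Finset.sum_congr rfl fun k _ => ?_
  rw [Finset.smul_sum, ← Finset.sum_add_distrib, ← Finset.sum_sub_distrib]
  refine Finset.sum_congr rfl fun l _ => ?_
  simp only [R, K, lam, smul_smul, ← add_smul, ← sub_smul]
  split_ifs <;> push_cast <;> congr 1 <;> ring

end lin

/-- The indices of `Fin (N + 2)` other than the first and the last one, numbered by `Fin N`. -/
def mid {N : ℕ} (i : Fin N) : Fin (N + 2) := i.succ.castSucc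

theorem sum_ends {M : Type*} [AddCommMonoid M] {N : ℕ} (f : Fin (N + 2) → M) :
    ∑ i, f i = f 0 + ∑ i, f (mid i) + f (Fin.last (N + 1)) := by
  rw [Fin.sum_univ_castSucc, Fin.sum_univ_succ]; rfl

theorem ends_cases {N : ℕ} (a : Fin (N + 2)) :
    a = 0 ∨ (∃ i : Fin N, a = mid i) ∨ a = Fin.last (N + 1) := by
  refine Fin.lastCases (Or.inr (Or.inr rfl)) (fun a => ?_) a
  refine Fin.cases (Or.inl rfl) (fun i => Or.inr (Or.inl ⟨i, rfl⟩)) a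

section ends
variable {N : ℕ} (i j : Fin N)

@[simp] theorem mid_inj : mid i = mid j ↔ i = j := by simp [mid]
@[simp] theorem mid_lt_mid : mid i < mid j ↔ i < j := by simp [mid]
@[simp] theorem rev_mid : (mid i).rev = mid i.rev := by
  apply Fin.ext; simp [mid, Fin.rev]; omega
@[simp] theorem zero_lt_mid : 0 < mid i := by simp [mid, Fin.lt_def]
@[simp] theorem mid_lt_last : mid i < Fin.last (N + 1) := by simp [mid, Fin.lt_def]
@[simp] theorem not_last_lt (a : Fin (N + 2)) : ¬ Fin.last (N + 1) < a := not_lt.2 (Fin.le_last a)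
@[simp] theorem mid_ne_zero : mid i ≠ 0 := (zero_lt_mid i).ne'
@[simp] theorem zero_ne_mid : 0 ≠ mid i := (zero_lt_mid i).ne
@[simp] theorem mid_ne_last : mid i ≠ Fin.last (N + 1) := (mid_lt_last i).ne
@[simp] theorem last_ne_mid : Fin.last (N + 1) ≠ mid i := (mid_lt_last i).ne'
@[simp] theorem zero_ne_last' : (0 : Fin (N + 2)) ≠ Fin.last (N + 1) := (Fin.last_pos).ne
@[simp] theorem last_ne_zero' : Fin.last (N + 1) ≠ (0 : Fin (N + 2)) := (Fin.last_pos).ne'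
@[simp] theorem zero_lt_last' : (0 : Fin (N + 2)) < Fin.last (N + 1) := Fin.last_pos

/-- The numbers `ϱ_i` do not change if an outermost pair of indices is added. -/
theorem rho_mid : rho (mid i) = rho i := by
  have h1 : ((mid i : Fin (N + 2)) : ℕ) = i + 1 := by simp [mid]
  have e1 : (2 * ((i : ℕ) + 1 + 1) < N + 2 + 1) = (2 * ((i : ℕ) + 1) < N + 1) := by
    apply propext; omega
  have e2 : (2 * ((i : ℕ) + 1 + 1) = N + 2 + 1) = (2 * ((i : ℕ) + 1) = N + 1) := by
    apply propext; omega
  simp only [rho, h1, e1, e2]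
  push_cast
  split_ifs <;> ring

theorem rho_zero : rho (0 : Fin (N + 2)) = N / 2 := by
  rw [rho, if_pos (by rw [Fin.val_zero]; omega)]
  rw [Fin.val_zero]; push_cast; ring

theorem rho_last : rho (Fin.last (N + 1)) = -(N / 2) := by
  rw [rho, if_neg (by rw [Fin.val_last]; omega), if_neg (by rw [Fin.val_last]; omega)]
  rw [Fin.val_last]; push_cast; ring

theorem rho_rev : rho i.rev = -rho i := by
  have hi := i.2
  have h1 : ((i.rev : Fin N) : ℕ) = N - 1 - i := by simp [Fin.rev]; omega
  have h2 : (((N - 1 - i : ℕ)) : ℝ) = N - 1 - i := by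
    rw [Nat.cast_sub (by omega), Nat.cast_sub (by omega)]; simp
  simp only [rho, h1, h2]
  split_ifs <;> first | (exfalso; omega) | ring

end ends

/-- The number `q^{N/2}`, which is the entry of the metric for `N + 2` at the last and first index.
-/
def hp (q : ℝ) (N : ℕ) : ℝ := q ^ ((N : ℝ) / 2)

section Crules
variable {N : ℕ} (q : ℝ) (i j : Fin N)

@[simp] theorem C_mid_mid : C q (mid i) (mid j) = C q i j := by
  simp [C, rho_mid]
theorem C_zero_last (hq : 0 < q) : C q 0 (Fin.last (N + 1)) = (hp q N)⁻¹ := by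
  simp [C, rho_zero, hp, Real.rpow_neg hq.le]
@[simp] theorem C_last_zero : C q (Fin.last (N + 1)) 0 = hp q N := by
  simp [C, rho_last, hp]
@[simp] theorem C_zero_mid : C q 0 (mid i) = 0 := by simp [C]
@[simp] theorem C_mid_zero : C q (mid i) 0 = 0 := by simp [C]
@[simp] theorem C_last_mid : C q (Fin.last _) (mid i) = 0 := by simp [C]
@[simp] theorem C_mid_last : C q (mid i) (Fin.last _) = 0 := by simp [C]
@[simp] theorem C_zero_zero : C q (0 : Fin (N + 2)) 0 = 0 := by simp [C]
@[simp] theorem C_last_last : C q (Fin.last (N + 1)) (Fin.last _) = 0 := by simp [C]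
end Crules

/-! ### Recursion from `N` to `N + 2` -/

section rules
variable {N : ℕ} {q : ℝ} (hq : 0 < q) (G : Fin (N + 2) → Fin (N + 2) → V) (i j : Fin N)

theorem Rop_zero_zero : Rop q G 0 0 = (q : ℂ) • G 0 0 := by
  simp [Rop_apply]

theorem Rop_zero_mid : Rop q G 0 (mid j) = G (mid j) 0 + (lam q : ℂ) • G 0 (mid j) := by
  simp [Rop_apply]

theorem Rop_mid_zero : Rop q G (mid i) 0 = G 0 (mid i) := by
  simp [Rop_apply]

theorem Rop_mid_last : Rop q G (mid i) (Fin.last _) =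
    G (Fin.last _) (mid i) + (lam q : ℂ) • G (mid i) (Fin.last _) := by
  simp [Rop_apply]

theorem Rop_last_mid : Rop q G (Fin.last _) (mid i) = G (mid i) (Fin.last _) := by
  simp [Rop_apply]

theorem Rop_last_last : Rop q G (Fin.last _) (Fin.last _) =
    (q : ℂ) • G (Fin.last _) (Fin.last _) := by
  simp [Rop_apply]

theorem Rop_last_zero : Rop q G (Fin.last _) 0 = (q : ℂ)⁻¹ • G 0 (Fin.last _) := by
  simp [Rop_apply]

include hq in
/-- The row of the first and last index, the only one in which the contraction for `N` appears. -/
theorem Rop_zero_last : Rop q G 0 (Fin.last _) =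
    (q : ℂ)⁻¹ • G (Fin.last _) 0 + (lam q : ℂ) • G 0 (Fin.last _) -
    ((lam q : ℂ) * (hp q N : ℂ)⁻¹) • (Ct q (fun k l => G (mid k) (mid l)) +
      (hp q N : ℂ)⁻¹ • G 0 (Fin.last _)) := by
  simp [Rop_apply, sum_ends, C_zero_last q hq, Ct, add_comm, -Complex.coe_smul]

include hq in
/-- On inner indices `R̂` for `N + 2` is `R̂` for `N` up to a multiple of the metric. -/
theorem Rop_mid_mid : Rop q G (mid i) (mid j) =
    Rop q (fun k l => G (mid k) (mid l)) i j -
    (hp q N : ℂ)⁻¹ • ((lam q : ℂ) * (C q i j : ℂ)) • G 0 (Fin.last _) := by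
  simp [Rop_apply, sum_ends, C_zero_last q hq]
  module

include hq in
theorem Ct_ends : Ct q G = (hp q N : ℂ)⁻¹ • G 0 (Fin.last _) +
    Ct q (fun k l => G (mid k) (mid l)) + (hp q N : ℂ) • G (Fin.last _) 0 := by
  simp [Ct, sum_ends, C_zero_last q hq, -Complex.coe_smul]
end rules

theorem hp_pos {q : ℝ} (hq : 0 < q) (N : ℕ) : 0 < hp q N := Real.rpow_pos_of_pos hq _

theorem hp_add_two {q : ℝ} (hq : 0 < q) (N : ℕ) : hp q (N + 2) = hp q N * q := by
  rw [hp, hp, ← Real.rpow_add_one hq.ne']; congr 1; push_cast; ring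

theorem hp_sq {q : ℝ} (hq : 0 < q) (N : ℕ) : hp q N ^ 2 = q ^ N := by
  rw [hp, ← Real.rpow_mul_natCast hq.le, ← Real.rpow_natCast]; congr 1; push_cast; ring

theorem two_step {P : ℕ → Prop} (h0 : P 0) (h1 : P 1) (h : ∀ N, P N → P (N + 2)) (N : ℕ) : P N := by
  induction N using Nat.twoStepInduction with
  | zero => exact h0
  | one => exact h1
  | more n h2 _ => exact h n h2

theorem R_one (q : ℝ) (k l i j : Fin 1) : R q k l i j = 1 := by
  simp [R, Subsingleton.elim k 0, Subsingleton.elim l 0, Subsingleton.elim i 0, Subsingleton.elim j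
    0]

theorem C_one (q : ℝ) (i j : Fin 1) : C q i j = 1 := by
  simp [C, rho, Subsingleton.elim i 0, Subsingleton.elim j 0]

theorem Rop_one (q : ℝ) (G : Fin 1 → Fin 1 → V) (i j : Fin 1) : Rop q G i j = G i j := by
  simp [Rop, R_one, Subsingleton.elim i 0, Subsingleton.elim j 0]

theorem Ct_one (q : ℝ) (G : Fin 1 → Fin 1 → V) (i j : Fin 1) : Ct q G = G i j := by
  simp [Ct, C_one, Subsingleton.elim i 0, Subsingleton.elim j 0]

/-- The contraction of `C` with itself, multiplied by `λ` to clear the denominator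
`q - q⁻¹` of the quantum dimension. -/
theorem lam_mul_Ct_C {q : ℝ} (hq : 0 < q) (N : ℕ) :
    (lam q : ℂ) * Ct q (fun k l : Fin N => (C q k l : ℂ)) =
      lam q + (hp q N : ℂ) ^ 2 * (q : ℂ)⁻¹ - ((hp q N : ℂ) ^ 2)⁻¹ * q := by
  have hq' : (q : ℂ) ≠ 0 := by exact_mod_cast hq.ne'
  induction N using two_step with
  | h0 => simp [Ct, hp, lam]
  | h1 =>
    rw [Ct_one q _ 0 0, ← Complex.ofReal_pow, hp_sq hq]; simp [C_one]; field_simp; ring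
  | h N ih =>
    have hs : (hp q N : ℂ) ≠ 0 := by exact_mod_cast (hp_pos hq N).ne'
    rw [Ct_ends hq]
    simp only [C_mid_mid, C_zero_last q hq, C_last_zero, hp_add_two hq]
    rw [mul_add, mul_add, ih]
    simp only [lam]
    push_cast
    simp only [smul_eq_mul]
    field_simp
    ring

/-- `C` is an eigenvector of `R̂` with eigenvalue `q^{1-N}`. -/
theorem Rop_C {q : ℝ} (hq : 0 < q) (N : ℕ) (i j : Fin N) :
    Rop q (fun k l : Fin N => (C q k l : ℂ)) i j =
      (q * ((hp q N : ℂ) ^ 2)⁻¹) * (C q i j : ℂ) := by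
  have hq' : (q : ℂ) ≠ 0 := by exact_mod_cast hq.ne'
  induction N using two_step with
  | h0 => exact i.elim0
  | h1 =>
    rw [Rop_one, ← Complex.ofReal_pow, hp_sq hq]; simp [hq']
  | h N ih =>
    have hs : (hp q N : ℂ) ≠ 0 := by exact_mod_cast (hp_pos hq N).ne'
    have hC := lam_mul_Ct_C hq N
    rcases ends_cases i with rfl | ⟨i, rfl⟩ | rfl <;>
    rcases ends_cases j with rfl | ⟨j, rfl⟩ | rfl <;>
      simp only [Rop_zero_zero, Rop_zero_mid, Rop_mid_zero, Rop_mid_last, Rop_last_mid,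
        Rop_last_last, Rop_last_zero, Rop_zero_last hq, Rop_mid_mid hq, C_mid_mid,
        C_zero_last q hq, C_last_zero,
        C_zero_zero, C_zero_mid, C_mid_zero, C_last_last, C_last_mid, C_mid_last, ih, smul_eq_mul,
        Complex.ofReal_zero, mul_zero, add_zero, hp_add_two hq]
    · rw [mul_add, mul_right_comm, hC]
      simp only [lam]
      push_cast
      field_simp
      ring
    · simp only [lam]
      push_cast
      field_simp
      ring
    · push_cast
      field_simp

theorem Rop_C_smul {q : ℝ} (hq : 0 < q) {N : ℕ} (c : ℂ) (v : V) (i j : Fin N) :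
    Rop q (fun k l : Fin N => (c * (C q k l : ℂ)) • v) i j =
      (q * ((hp q N : ℂ) ^ 2)⁻¹) • (c * (C q i j : ℂ)) • v := by
  have h := map_Rop q (fun k l : Fin N => (C q k l : ℂ)) (LinearMap.toSpanSingleton ℂ V (c • v)) i j
  rw [Rop_C hq] at h
  simp only [LinearMap.toSpanSingleton_apply, smul_smul] at h
  simp only [mul_comm c]
  rw [← h, smul_smul]
  congr 1; ring

theorem Ct_C_smul {q : ℝ} (hq : 0 < q) {N : ℕ} (v : V) :
    Ct q (fun k l : Fin N => ((lam q : ℂ) * (C q k l : ℂ)) • v) =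
      (lam q + (hp q N : ℂ) ^ 2 * (q : ℂ)⁻¹ - ((hp q N : ℂ) ^ 2)⁻¹ * q) • v := by
  have h := map_Ct q (fun k l : Fin N => (C q k l : ℂ))
    (LinearMap.toSpanSingleton ℂ V ((lam q : ℂ) • v))
  simp only [LinearMap.toSpanSingleton_apply, smul_smul] at h
  rw [← lam_mul_Ct_C hq, mul_comm, h]
  simp only [mul_comm]

/-- Dually to `Rop_C`, the contraction with `C` is a left eigenvector of `R̂`. -/
theorem Ct_Rop {q : ℝ} (hq : 0 < q) (N : ℕ) (G : Fin N → Fin N → V) :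
    Ct q (fun i j => Rop q G i j) = (q * ((hp q N : ℂ) ^ 2)⁻¹) • Ct q G := by
  have hq' : (q : ℂ) ≠ 0 := by exact_mod_cast hq.ne'
  induction N using two_step with
  | h0 => simp [Ct]
  | h1 =>
    rw [Ct_one q _ 0 0, Rop_one, Ct_one q _ 0 0, ← Complex.ofReal_pow, hp_sq hq]; simp [hq']
  | h N ih =>
    have hs : (hp q N : ℂ) ≠ 0 := by exact_mod_cast (hp_pos hq N).ne'
    rw [Ct_ends hq, Ct_ends hq]
    simp only [Rop_last_zero, Rop_zero_last hq, Rop_mid_mid hq, Ct_sub, Ct_smul, ih, Ct_C_smul hq,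
      hp_add_two hq]
    simp only [lam]
    push_cast
    match_scalars <;> field_simp <;> ring

/-! ### The quadratic relation, rotations and the Yang-Baxter equation -/

section relations

set_option linter.unusedSimpArgs false

/-- The relation `R̂² = 1 + λ R̂ - q^{1-N} λ K`, which says that `Rinv` is the inverse of `R̂`. -/
theorem Rop_Rop {q : ℝ} (hq : 0 < q) (N : ℕ) (G : Fin N → Fin N → V) (i j : Fin N) :
    Rop q (fun k l => Rop q G k l) i j = G i j + (lam q : ℂ) • Rop q G i j -
      (q * ((hp q N : ℂ) ^ 2)⁻¹) • ((lam q : ℂ) * (C q i j : ℂ)) • Ct q G := by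
  have hq' : (q : ℂ) ≠ 0 := by exact_mod_cast hq.ne'
  induction N using two_step with
  | h0 => exact i.elim0
  | h1 =>
    rw [Rop_one, Rop_one, Ct_one q _ i j, ← Complex.ofReal_pow, hp_sq hq, C_one]
    simp [hq']
  | h N ih =>
    have hs : (hp q N : ℂ) ≠ 0 := by exact_mod_cast (hp_pos hq N).ne'
    rcases ends_cases i with rfl | ⟨i, rfl⟩ | rfl <;>
    rcases ends_cases j with rfl | ⟨j, rfl⟩ | rfl <;>
      simp only [Rop_zero_zero, Rop_zero_mid, Rop_mid_zero, Rop_mid_last, Rop_last_mid,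
        Rop_last_last, Rop_last_zero, Rop_zero_last hq, Rop_mid_mid hq, C_mid_mid,
        C_zero_last q hq, C_last_zero,
        C_zero_zero, C_zero_mid, C_mid_zero, C_last_last, C_last_mid, C_mid_last, ih,
        Rop_sub, Rop_smul, Rop_C_smul hq, Ct_Rop hq, Ct_C_smul hq, Ct_sub, Ct_ends hq, Ct_smul,
        hp_add_two hq] <;>
      simp only [lam] <;> push_cast <;> match_scalars <;> field_simp <;> ring

theorem C_mul_C_rev {q : ℝ} (hq : 0 < q) {N : ℕ} (i : Fin N) :
    (C q i i.rev : ℂ) * (C q i.rev i : ℂ) = 1 := by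
  rw [← Complex.ofReal_mul, C, C, if_pos (by simp), if_pos rfl, rho_rev, ← Real.rpow_add hq]
  simp

theorem Ct_C_left {q : ℝ} (hq : 0 < q) {N : ℕ} (s : ℂ) (g : Fin N → V) (a : Fin N) :
    Ct q (fun k l => (s * (C q a k : ℂ)) • g l) = s • g a := by
  rw [Ct, Finset.sum_eq_single a.rev, Finset.sum_eq_single a]
  · rw [smul_smul, mul_left_comm, mul_comm (C q a.rev a : ℂ), C_mul_C_rev hq, mul_one]
  · intro l _ hl; simp [C, Ne.symm hl]
  · simp
  · intro k _ hk
    have : a ≠ k.rev := fun h => hk (by rw [h, Fin.rev_rev])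
    simp [C, this]
  · simp

theorem Ct_C_right {q : ℝ} (hq : 0 < q) {N : ℕ} (s : ℂ) (g : Fin N → V) (c : Fin N) :
    Ct q (fun k l => (s * (C q l c : ℂ)) • g k) = s • g c := by
  rw [Ct, Finset.sum_eq_single c, Finset.sum_eq_single c.rev]
  · rw [smul_smul, mul_left_comm, C_mul_C_rev hq, mul_one]
  · intro l _ hl; simp [C, hl]
  · simp
  · intro k _ hk
    refine Finset.sum_eq_zero fun l _ => ?_
    by_cases h : l = c.rev
    · subst h; simp [C, hk]
    · simp [C, h]
  · simp

theorem Rop_zero_fun (q : ℝ) {N : ℕ} (i j : Fin N) : Rop q (fun _ _ => (0 : V)) i j = 0 := by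
  simp [Rop]

theorem Ct_zero_fun (q : ℝ) {N : ℕ} : Ct q (fun _ _ : Fin N => (0 : V)) = 0 := by
  simp [Ct]

/-- The identity `C₁₂ R̂₂₃ = C₂₃ R̂₁₂⁻¹` of contractions of three indices, where `R̂⁻¹` is written
out in terms of `R̂`. -/
theorem Ct_Rop_rotate {q : ℝ} (hq : 0 < q) (N : ℕ) (F : Fin N → Fin N → Fin N → V) (c : Fin N) :
    Ct q (fun a b => Rop q (fun k l => F a k l) b c) =
      Ct q (fun a b => Rop q (fun k l => F k l b) c a) - (lam q : ℂ) • Ct q (fun a b => F c a b) +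
        (lam q : ℂ) • Ct q (fun a b => F a b c) := by
  have hq' : (q : ℂ) ≠ 0 := by exact_mod_cast hq.ne'
  induction N using two_step with
  | h0 => exact c.elim0
  | h1 =>
    simp only [Rop_one, Ct_one q _ c c, Subsingleton.elim _ c]; abel
  | h N ih =>
    have hs : (hp q N : ℂ) ≠ 0 := by exact_mod_cast (hp_pos hq N).ne'
    rcases ends_cases c with rfl | ⟨c, rfl⟩ | rfl <;>
      simp only [Rop_zero_zero, Rop_zero_mid, Rop_mid_zero, Rop_mid_last, Rop_last_mid,
        Rop_last_last, Rop_last_zero, Rop_zero_last hq, Rop_mid_mid hq, Ct_ends hq, ih,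
        Rop_C_smul hq, Ct_Rop hq, Ct_C_smul hq, Ct_sub, Ct_add, Ct_smul, Ct_C_left hq,
        Ct_C_right hq] <;>
      simp only [lam] <;> push_cast <;> match_scalars <;> field_simp <;> ring

/-- The identity `R̂₂₃ C₁₂ = R̂₁₂⁻¹ C₂₃`, the counterpart of `Ct_Rop_rotate` in which the metric is
inserted instead of contracted. The factors `λ` match the multiples of the metric that occur in the
recursion for `R̂`. -/
theorem Rop_C_rotate {q : ℝ} (hq : 0 < q) (N : ℕ) (g : Fin N → V) (a b c : Fin N) :
    Rop q (fun k l => ((lam q : ℂ) * (C q a k : ℂ)) • g l) b c =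
    Rop q (fun k l => ((lam q : ℂ) * (C q l c : ℂ)) • g k) a b -
      (lam q : ℂ) • ((lam q : ℂ) * (C q b c : ℂ)) • g a
      + (lam q : ℂ) • ((lam q : ℂ) * (C q a b : ℂ)) • g c := by
  have hq' : (q : ℂ) ≠ 0 := by exact_mod_cast hq.ne'
  induction N using two_step with
  | h0 => exact c.elim0
  | h1 =>
    simp only [Rop_one, C_one, Subsingleton.elim _ c]; simp
  | h N ih =>
    have hs : (hp q N : ℂ) ≠ 0 := by exact_mod_cast (hp_pos hq N).ne'
    rcases ends_cases a with rfl | ⟨a, rfl⟩ | rfl <;>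
    rcases ends_cases b with rfl | ⟨b, rfl⟩ | rfl <;>
    rcases ends_cases c with rfl | ⟨c, rfl⟩ | rfl <;>
      simp only [Rop_zero_zero, Rop_zero_mid, Rop_mid_zero, Rop_mid_last, Rop_last_mid,
        Rop_last_last, Rop_last_zero, Rop_zero_last hq, Rop_mid_mid hq, ih, C_mid_mid,
        C_zero_last q hq,
        C_last_zero, C_zero_zero, C_zero_mid,
        C_mid_zero, C_last_last, C_last_mid, C_mid_last, Complex.ofReal_zero, zero_smul, mul_zero,
        Rop_zero_fun, Ct_zero_fun, Ct_C_left hq, Ct_C_right hq] <;>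
      simp only [lam] <;> push_cast <;> match_scalars <;> field_simp <;> ring

/-- A contracted pair slides through a third index: `C₁₂ R̂₂₃ R̂₁₂ = C₂₃`. -/
theorem Ct_Rop_Rop_slide {q : ℝ} (hq : 0 < q) (N : ℕ) (F : Fin N → Fin N → Fin N → V) (c : Fin N) :
    Ct q (fun a b => Rop q (fun b' c' => Rop q (fun k l => F k l c') a b') b c) =
      Ct q (fun a b => F c a b) := by
  simp only [Ct_Rop_rotate hq N (fun a b' c' => Rop q (fun k l => F k l c') a b'), Rop_Rop hq,
    Ct_Rop hq, Ct_add,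
    Ct_sub, Ct_smul, Ct_C_left hq]
  match_scalars <;> field_simp <;> ring

/-- A contracted pair slides through a third index: `C₂₃ R̂₁₂ R̂₂₃ = C₁₂`. -/
theorem Ct_Rop_Rop_slide_symm {q : ℝ} (hq : 0 < q) (N : ℕ) (F : Fin N → Fin N → Fin N → V)
    (a : Fin N) :
    Ct q (fun b c => Rop q (fun a' b' => Rop q (fun k l => F a' k l) b' c) a b) =
      Ct q (fun b c => F b c a) := by
  have h := Ct_Rop_rotate hq N (fun a b' c' => Rop q (fun k l => F a k l) b' c') a
  simp only [Rop_Rop hq, Ct_Rop hq, Ct_add, Ct_sub, Ct_smul, Ct_C_right hq] at h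
  linear_combination (norm := module) (-1 : ℂ) • h

/-- An inserted metric slides through a third index: `R̂₁₂ R̂₂₃ C₁₂ = C₂₃`. -/
theorem Rop_Rop_C_slide {q : ℝ} (hq : 0 < q) (N : ℕ) (g : Fin N → V) (a b c : Fin N) :
    Rop q (fun a b => Rop q (fun k l => ((lam q : ℂ) * (C q a k : ℂ)) • g l) b c) a b =
      ((lam q : ℂ) * (C q b c : ℂ)) • g a := by
  simp only [Rop_C_rotate hq N g, Rop_add, Rop_sub, Rop_smul, Rop_Rop hq, Rop_C_smul hq,
    Ct_C_right hq]
  module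

/-- An inserted metric slides through a third index: `R̂₂₃ R̂₁₂ C₂₃ = C₁₂`. -/
theorem Rop_Rop_C_slide_symm {q : ℝ} (hq : 0 < q) (N : ℕ) (g : Fin N → V) (a b c : Fin N) :
    Rop q (fun b c => Rop q (fun k l => ((lam q : ℂ) * (C q l c : ℂ)) • g k) a b) b c =
      ((lam q : ℂ) * (C q a b : ℂ)) • g c := by
  have e : ∀ a b c, Rop q (fun k l => ((lam q : ℂ) * (C q l c : ℂ)) • g k) a b =
      Rop q (fun k l => ((lam q : ℂ) * (C q a k : ℂ)) • g l) b c +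
      (lam q : ℂ) • ((lam q : ℂ) * (C q b c : ℂ)) • g a
      - (lam q : ℂ) • ((lam q : ℂ) * (C q a b : ℂ)) • g c := fun a b c => by
    rw [Rop_C_rotate hq N g]; abel
  simp only [e, Rop_add, Rop_sub, Rop_smul, Rop_Rop hq, Rop_C_smul hq, Ct_C_left hq]
  module

/-- The Yang-Baxter equation `R̂₁₂ R̂₂₃ R̂₁₂ = R̂₂₃ R̂₁₂ R̂₂₃`. -/
theorem yang_baxter {q : ℝ} (hq : 0 < q) (N : ℕ) (F : Fin N → Fin N → Fin N → V) (a b c : Fin N) :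
    Rop q (fun a b => Rop q (fun b c => Rop q (fun a b => F a b c) a b) b c) a b =
    Rop q (fun b c => Rop q (fun a b => Rop q (fun b c => F a b c) b c) a b) b c := by
  have hq' : (q : ℂ) ≠ 0 := by exact_mod_cast hq.ne'
  induction N using two_step with
  | h0 => exact a.elim0
  | h1 => simp only [Rop_one]
  | h N ih =>
    have hs : (hp q N : ℂ) ≠ 0 := by exact_mod_cast (hp_pos hq N).ne'
    rcases ends_cases a with rfl | ⟨a, rfl⟩ | rfl <;>
    rcases ends_cases b with rfl | ⟨b, rfl⟩ | rfl <;>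
    rcases ends_cases c with rfl | ⟨c, rfl⟩ | rfl <;>
      simp only [Rop_zero_zero, Rop_zero_mid, Rop_mid_zero, Rop_mid_last, Rop_last_mid,
        Rop_last_last, Rop_last_zero, Rop_zero_last hq, Rop_mid_mid hq,
        Rop_add, Rop_sub, Rop_smul, Rop_C_smul hq, Ct_Rop hq, Ct_C_smul hq, Ct_sub, Ct_add, Ct_smul,
        Rop_Rop hq, Rop_Rop_C_slide hq, Rop_Rop_C_slide_symm hq, Ct_C_left hq, Ct_C_right hq]
    -- Four of the 27 cases need more than linear algebra: three in which one index is inner and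
    -- the two others are the outermost ones, where the metric is rotated or slides, and that of
    -- three inner indices, where the induction hypothesis enters.
    all_goals try ((try simp only [lam]); (try push_cast); match_scalars <;> field_simp <;> ring1)
    · rw [Ct_Rop_rotate hq N (fun a b c => F (mid a) (mid b) (mid c))]
      match_scalars <;> field_simp <;> ring1
    · rw [Ct_Rop_Rop_slide hq N (fun a b c => F (mid a) (mid b) (mid c)),
        Ct_Rop_rotate hq N (fun a b c => ((lam q : ℂ) * (C q a b : ℂ)) • F 0 (Fin.last _) (mid c))]
      simp only [Rop_C_smul hq, Ct_smul, Ct_C_left hq, Ct_C_smul hq]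
      simp only [lam]; push_cast; match_scalars <;> field_simp <;> ring1
    · rw [Ct_Rop_Rop_slide_symm hq N (fun a b c => F (mid a) (mid b) (mid c))]
      have h := Ct_Rop_rotate hq N
        (fun a b c => ((lam q : ℂ) * (C q b c : ℂ)) • F (mid a) 0 (Fin.last _)) a
      simp only [Rop_C_smul hq, Ct_smul, Ct_C_right hq, Ct_C_smul hq] at h
      have h' := eq_add_of_sub_eq (eq_sub_of_add_eq h.symm)
      rw [h']
      simp only [lam]; push_cast; match_scalars <;> field_simp <;> ring1
    · rw [ih (fun a b c => F (mid a) (mid b) (mid c)),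
        Rop_C_rotate hq N (fun l => F 0 (mid l) (Fin.last _))]
      module

end relations

/-! ### Points of the sphere -/

/-- The coefficient of `K` in the relations of the sphere. -/
def cK (q : ℝ) (N : ℕ) : ℝ :=
  (q ^ ((N : ℤ) - 1) - q ^ ((N : ℤ) - 3)) / (1 + q ^ ((N : ℤ) - 2))

/-- The elements `y_i` satisfy the defining relations of the sphere. The commutation relations are
written with `R̂` in place of `R̂⁻¹`, and `C^{kl} y_k y_l` is replaced by `1` in them. -/
def IsPoint {B : Type*} [Ring B] [Algebra ℂ B] (q : ℝ) {N : ℕ} (y : Fin N → B) : Prop :=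
  (∀ i j, Rop q (fun k l => y k * y l) i j =
    (q : ℂ) • (y i * y j) + ((cK q N - lam q : ℝ) : ℂ) • (C q i j : ℂ) • (1 : B)) ∧
  Ct q (fun k l => y k * y l) = 1

section Point
variable {B : Type*} [Ring B] [Algebra ℂ B] {q : ℝ} {N : ℕ} {y : Fin N → B}

theorem Riop_of_isPoint (h : IsPoint q y) (i j : Fin N) : Riop q (fun k l => y k * y l) i j =
    ((q⁻¹ : ℝ) : ℂ) • (y i * y j) + (cK q N : ℂ) • (C q i j : ℂ) • (1 : B) := by
  rw [Riop_eq, h.1, h.2]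
  simp only [lam]
  push_cast
  module

theorem sum_K_smul (G : Fin N → Fin N → V) (i j : Fin N) :
    ∑ k, ∑ l, (K q k l i j : ℂ) • G k l = (C q i j : ℂ) • Ct q G := by
  simp only [K, Ct, Finset.smul_sum, smul_smul, Complex.ofReal_mul]

theorem isPoint_x (q : ℝ) (N : ℕ) : IsPoint q (x q : Fin N → Sphere q N) := by
  have h2 : Ct q (fun k l => x q k * x q l : Fin N → Fin N → Sphere q N) = 1 := by
    have h := RingQuot.mkAlgHom_rel ℂ (SphereRel.radius (q := q) (N := N))
    simp only [map_sum, map_smul, map_mul, map_one] at h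
    exact h
  refine ⟨fun i j => ?_, h2⟩
  have h : Riop q (fun k l => x q k * x q l : Fin N → Fin N → Sphere q N) i j =
      ((q⁻¹ : ℝ) : ℂ) • (x q i * x q j) + (cK q N : ℂ) • (C q i j : ℂ) • (1 : Sphere q N) := by
    have h := RingQuot.mkAlgHom_rel ℂ (SphereRel.comm (q := q) i j)
    simp only [map_sum, map_smul, map_mul, map_add] at h
    rw [← h2, ← sum_K_smul]
    exact h
  rw [Riop_eq, h2] at h
  rw [eq_add_of_sub_eq (eq_sub_of_add_eq h)]
  simp only [lam]
  push_cast
  module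

/-- The homomorphism from the sphere which maps the generators to a tuple satisfying its relations.
-/
def Sphere.lift (h : IsPoint q y) : Sphere q N →ₐ[ℂ] B :=
  RingQuot.liftAlgHom ℂ ⟨FreeAlgebra.lift ℂ y, fun a b hab => by
    cases hab with
    | comm i j =>
      simp only [map_sum, map_smul, map_mul, map_add, FreeAlgebra.lift_ι_apply]
      rw [sum_K_smul, h.2]
      exact Riop_of_isPoint h i j
    | radius =>
      simp only [map_sum, map_smul, map_mul, map_one, FreeAlgebra.lift_ι_apply]
      exact h.2⟩

theorem Sphere.lift_x (h : IsPoint q y) (i : Fin N) : Sphere.lift h (x q i) = y i := by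
  rw [x, Sphere.lift, RingQuot.liftAlgHom_mkAlgHom_apply, FreeAlgebra.lift_ι_apply]

theorem Sphere.induction {P : Sphere q N → Prop} (scalar : ∀ c, P (algebraMap ℂ _ c))
    (gen : ∀ i, P (x q i)) (mul : ∀ a b, P a → P b → P (a * b))
    (add : ∀ a b, P a → P b → P (a + b)) (a : Sphere q N) : P a := by
  obtain ⟨a, rfl⟩ := RingQuot.mkAlgHom_surjective ℂ (SphereRel q N) a
  induction a using FreeAlgebra.induction with
  | grade0 r => rw [AlgHom.commutes]; exact scalar r
  | grade1 i => exact gen i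
  | mul a b ha hb => rw [map_mul]; exact mul _ _ ha hb
  | add a b ha hb => rw [map_add]; exact add _ _ ha hb

end Point

section Module
variable {q : ℝ} (hq : 0 < q) {N : ℕ} {M : Type*} [AddCommGroup M] [Module ℂ M]
  [Module (Sphere q N) M] [IsScalarTower ℂ (Sphere q N) M]

theorem Rop_x_x_smul (v : M) (i j : Fin N) : Rop q (fun k l => x q k • x q l • v) i j =
    (q : ℂ) • x q i • x q j • v + ((cK q N - lam q : ℝ) : ℂ) • (C q i j : ℂ) • v := by
  simp only [← mul_smul (x q _)]
  have h := map_Rop q (fun k l : Fin N => x q k * x q l)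
    ((LinearMap.toSpanSingleton (Sphere q N) M v).restrictScalars ℂ) i j
  simp only [LinearMap.coe_restrictScalars, LinearMap.toSpanSingleton_apply] at h
  rw [← h, (isPoint_x q N).1]
  simp only [add_smul, smul_assoc, one_smul, mul_smul]

theorem Ct_x_x_smul (v : M) : Ct q (fun k l : Fin N => x q k • x q l • v) = v := by
  simp only [← mul_smul (x q _)]
  have h := map_Ct q (fun k l : Fin N => x q k * x q l)
    ((LinearMap.toSpanSingleton (Sphere q N) M v).restrictScalars ℂ)
  simp only [LinearMap.coe_restrictScalars, LinearMap.toSpanSingleton_apply] at h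
  rw [← h, (isPoint_x q N).2, one_smul]

theorem smul_Ct (a : Sphere q N) (G : Fin N → Fin N → M) :
    a • Ct q G = Ct q (fun k l => a • G k l) := by
  simp only [Ct, Finset.smul_sum, smul_comm a]

theorem smul_Rop (a : Sphere q N) (G : Fin N → Fin N → M) (i j : Fin N) :
    a • Rop q G i j = Rop q (fun k l => a • G k l) i j := by
  simp only [Rop, Finset.smul_sum, smul_comm a]

include hq in
/-- Contraction of `x ⊗ R̂ (x ⊗ D)` in the first two factors. -/
theorem Ct_x_smul_Rop (D : Fin N → M) (j : Fin N) :
    Ct q (fun k i => x q k • Rop q (fun m n => x q m • D n) i j) =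
      (q : ℂ)⁻¹ • x q j • Ct q (fun k l => x q k • D l) + (cK q N : ℂ) • D j := by
  simp only [smul_Rop]
  have e1 : ∀ a b, Rop q (fun k l => x q k • x q l • D b) j a =
      (q : ℂ) • x q j • x q a • D b +
        (((cK q N - lam q : ℝ) : ℂ) * (C q j a : ℂ)) • D b := fun a b => by
    rw [Rop_x_x_smul, mul_smul]
  rw [Ct_Rop_rotate hq N (fun k m n => x q k • x q m • D n) j]
  simp only [e1, Ct_add, Ct_smul, Ct_C_left hq, Ct_x_x_smul, ← smul_Ct]
  generalize x q j • Ct q (fun k l => x q k • D l) = w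
  simp only [lam]
  push_cast
  module

include hq in
theorem Ct_x_smul_C (v : M) (j : Fin N) :
    Ct q (fun k i => x q k • (C q i j : ℂ) • v) = x q j • v := by
  have := Ct_C_right hq (N := N) 1 (fun k => x q k • v) j
  simpa only [one_mul, one_smul, smul_comm (x q _)] using this

end Module

/-! ### The bimodule relations of the two bases -/

/-- The coefficient of `K` in the bimodule relations of `Γ_±`. -/
def coefK (ε q : ℝ) (N : ℕ) : ℝ := (q ^ (N : ℤ) - q ^ ((N : ℤ) - 2)) / (1 - ε * q ^ ((N : ℤ) - 1))
/-- The coefficient of `x_i x_j η` in the bimodule relations of `Γ_±`. -/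
def coefC (ε q : ℝ) (N : ℕ) : ℝ :=
  (1 - ε * q) * (1 + q ^ ((N : ℤ) - 2)) / (1 - ε * q ^ ((N : ℤ) - 1))

section consts
variable {q : ℝ} (hq : 0 < q) {N : ℕ}

include hq in
theorem zpows (N : ℕ) : q ^ (N : ℤ) = q ^ ((N : ℤ) - 2) * q ^ 2 ∧
    q ^ ((N : ℤ) - 1) = q ^ ((N : ℤ) - 2) * q ∧ q ^ ((N : ℤ) - 3) = q ^ ((N : ℤ) - 2) * q⁻¹ := by
  refine ⟨?_, ?_, ?_⟩
  · rw [← zpow_natCast q 2, ← zpow_add₀ hq.ne']; congr 1; push_cast; ring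
  · rw [← zpow_add_one₀ hq.ne']; congr 1; ring
  · rw [← zpow_sub_one₀ hq.ne']; congr 1; ring

include hq in
theorem hp_sq' (N : ℕ) : hp q N ^ 2 = q ^ ((N : ℤ) - 2) * q ^ 2 := by
  rw [hp_sq hq, ← zpow_natCast q N, (zpows hq N).1]

variable (hq1 : q ≠ 1) (hN : 3 ≤ N) {ε : ℝ} (hε : ε = 1 ∨ ε = -1)
include hq hq1 hN hε

theorem denom_ne : 1 - ε * q ^ ((N : ℤ) - 1) ≠ 0 := by
  have h : q ^ ((N : ℤ) - 1) ≠ 1 := by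
    obtain ⟨m, rfl⟩ : ∃ m, N = m + 3 := ⟨N - 3, by omega⟩
    have : (((m + 3 : ℕ) : ℤ) - 1) = ((m + 2 : ℕ) : ℤ) := by push_cast; ring
    rw [this, zpow_natCast]
    exact fun h => hq1 ((pow_eq_one_iff_of_nonneg hq.le (by omega)).1 h)
  have h0 := zpow_pos hq ((N : ℤ) - 1)
  rcases hε with rfl | rfl
  · intro h'; apply h; linarith
  · linarith

omit hN in
theorem one_add_eps_mul_ne : 1 + ε * q ≠ 0 := by
  rcases hε with rfl | rfl
  · positivity
  · intro h; apply hq1; linarith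

/-- The relations between the structure constants, with `Q = q^{N-2}`. -/
theorem const_forms : ∃ Q D : ℝ, 0 < Q ∧ D ≠ 0 ∧ D = 1 - ε * (Q * q) ∧ hp q N ^ 2 = Q * q ^ 2 ∧
    cK q N = Q * lam q / (1 + Q) ∧
    coefK ε q N = Q * q * lam q / D ∧
    coefC ε q N = (1 - ε * q) * (1 + Q) / D ∧
    alphaPlus ε q N = - ((1 + Q) / D) ∧
    alphaMinus ε q N = ε * q * ((1 + Q) / D) := by
  have h := denom_ne hq hq1 hN hε
  obtain ⟨h1, h2, h3⟩ := zpows hq N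
  refine ⟨q ^ ((N : ℤ) - 2), _, zpow_pos hq _, h, by rw [← h2], hp_sq' hq N, ?_, ?_, ?_, ?_, ?_⟩
  · rw [cK, h2, h3, lam]; congr 1; ring
  · rw [coefK, h1, lam]; congr 1; field_simp
  · rw [coefC]
  · rw [alphaPlus]
  · rw [alphaMinus]

end consts

section calc1
variable {q : ℝ} (hq : 0 < q) {N : ℕ} (ε : ℝ)

theorem sum_mul_smul {M : Type*} [AddCommGroup M] [Module ℂ M]
    [Module (Sphere q N) M] [IsScalarTower ℂ (Sphere q N) M] (a : ℝ) (A : Fin N → Fin N → ℝ)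
    (g : Fin N → M) :
    ∑ k, ∑ l, (((a * A k l : ℝ) : ℂ) • x q k) • g l =
      (a : ℂ) • ∑ k, ∑ l, (A k l : ℂ) • x q k • g l := by
  simp only [Finset.smul_sum, smul_assoc, Complex.ofReal_mul, mul_smul]

theorem eta_eq : eta ε q N = Ct q (fun k l => x q k • dx ε q l) := by
  simp only [eta, Ct, smul_assoc]

/-- The right-hand side of the bimodule relations in terms of `R̂` and `η`, for arbitrary elements
`D l` in place of the `dx_l`. -/
theorem bimodule_sum_eq {M : Type*} [AddCommGroup M] [Module ℂ M]
    [Module (Sphere q N) M] [IsScalarTower ℂ (Sphere q N) M] (D : Fin N → M) {η : M}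
    (hη : Ct q (fun k l => x q k • D l) = η) (i j : Fin N) :
    (∑ k, ∑ l, (((ε * Rinv q k l i j : ℝ) : ℂ) • x q k) • D l) +
      (((ε * q - 1 : ℝ) : ℂ) • x q i) • D j +
      (∑ k, ∑ l, ((((q ^ (N : ℤ) - q ^ ((N : ℤ) - 2)) / (1 - ε * q ^ ((N : ℤ) - 1)) *
        K q k l i j : ℝ) : ℂ) • x q k) • D l) +
      ∑ k, ∑ l, ((((1 - ε * q) * (1 + q ^ ((N : ℤ) - 2)) / (1 - ε * q ^ ((N : ℤ) - 1)) *
        C q k l : ℝ) : ℂ) • (x q i * x q j * x q k)) • D l =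
    (ε : ℂ) • Rop q (fun k l => x q k • D l) i j +
    ((ε * q - 1 - ε * lam q : ℝ) : ℂ) • x q i • D j +
    ((coefK ε q N + ε * lam q : ℝ) : ℂ) • (C q i j : ℂ) • η +
    (coefC ε q N : ℂ) • x q i • x q j • η := by
  have h1 : ∑ k, ∑ l, (((ε * Rinv q k l i j : ℝ) : ℂ) • x q k) • D l =
      (ε : ℂ) • Riop q (fun k l => x q k • D l) i j := sum_mul_smul _ _ _
  have h2 : ∑ k, ∑ l, (((coefK ε q N * K q k l i j : ℝ) : ℂ) • x q k) • D l =
      (coefK ε q N : ℂ) • (C q i j : ℂ) • η := by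
    rw [sum_mul_smul, sum_K_smul, hη]
  have h3 : ∑ k, ∑ l, (((coefC ε q N * C q k l : ℝ) : ℂ) • (x q i * x q j * x q k)) • D l =
      (coefC ε q N : ℂ) • x q i • x q j • η := by
    rw [← hη, smul_Ct, smul_Ct, Ct, Finset.smul_sum]
    simp only [Finset.smul_sum, smul_assoc, Complex.ofReal_mul, mul_smul]
  simp only [coefK, coefC] at h1 h2 h3 ⊢
  rw [h1, h2, h3, Riop_eq, hη, smul_assoc]
  generalize x q i • D j = v1
  generalize x q i • x q j • η = v2
  push_cast
  module

theorem dx_smul (i j : Fin N) : dx ε q i <• x q j =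
    (ε : ℂ) • Rop q (fun k l => x q k • dx ε q l) i j +
    ((ε * q - 1 - ε * lam q : ℝ) : ℂ) • x q i • dx ε q j +
    ((coefK ε q N + ε * lam q : ℝ) : ℂ) • (C q i j : ℂ) • eta ε q N +
    (coefC ε q N : ℂ) • x q i • x q j • eta ε q N := by
  rw [dx_mul_x, bimodule_sum_eq ε (dx ε q) (eta_eq ε).symm]

include hq in
/-- Obtained by contracting the bimodule relations with `C^{ki} x_k`. -/
theorem eta_smul (j : Fin N) : eta ε q N <• x q j =
    ((ε * q + coefK ε q N + coefC ε q N : ℝ) : ℂ) • x q j • eta ε q N +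
    ((ε * (cK q N - lam q) + ε * q - 1 : ℝ) : ℂ) • dx ε q j := by
  have h : eta ε q N <• x q j = Ct q (fun k i => x q k • (dx ε q i <• x q j)) := by
    rw [eta_eq]
    simp only [Ct, Finset.smul_sum]
    refine Finset.sum_congr rfl fun k _ => Finset.sum_congr rfl fun i _ => ?_
    rw [smul_comm, ← smul_comm (x q k) (MulOpposite.op (x q j))]
  rw [h]
  simp only [dx_smul, smul_add, smul_comm (x q _) (_ : ℂ) (_ : Gam ε q N), Ct_add, Ct_smul]
  have h2 := Ct_x_smul_C hq (eta ε q N) j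
  simp only [smul_comm (x q _) (_ : ℂ) (_ : Gam ε q N)] at h2
  rw [Ct_x_smul_Rop hq, Ct_x_x_smul, Ct_x_x_smul, h2, ← eta_eq]
  generalize x q j • eta ε q N = v2
  simp only [lam]
  push_cast
  module

include hq in
theorem gam_smul (α : ℝ) (i j : Fin N) : gam ε q α i <• x q j =
    (ε : ℂ) • Rop q (fun k l => x q k • dx ε q l) i j +
    ((ε * q - 1 - ε * lam q + α * (ε * (cK q N - lam q) + ε * q - 1) : ℝ) : ℂ) •
      x q i • dx ε q j +
    ((coefK ε q N + ε * lam q : ℝ) : ℂ) • (C q i j : ℂ) • eta ε q N +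
    ((coefC ε q N + α * (ε * q + coefK ε q N + coefC ε q N) : ℝ) : ℂ) • x q i • x q j • eta ε q N
    := by
  rw [gam, smul_add, dx_smul, smul_assoc, smul_comm _ (α : ℂ),
    ← smul_comm (x q i) (MulOpposite.op (x q j)), eta_smul hq]
  simp only [smul_add, smul_comm (x q _) (_ : ℂ) (_ : Gam ε q N)]
  generalize x q i • dx ε q j = v1
  generalize x q i • x q j • eta ε q N = v2
  push_cast
  module

theorem Rop_gam (α : ℝ) (i j : Fin N) : Rop q (fun k l => x q k • gam ε q α l) i j =
    Rop q (fun k l => x q k • dx ε q l) i j +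
    ((α * q : ℝ) : ℂ) • x q i • x q j • eta ε q N +
    ((α * (cK q N - lam q) : ℝ) : ℂ) • (C q i j : ℂ) • eta ε q N := by
  simp only [gam, smul_add, smul_assoc, smul_comm (x q _) (_ : ℂ) (_ : Gam ε q N), Rop_add,
    Rop_smul, Rop_x_x_smul]
  generalize x q i • x q j • eta ε q N = v2
  push_cast
  module

theorem Ct_gam (α : ℝ) : Ct q (fun k l : Fin N => x q k • gam ε q α l) =
    ((1 + α : ℝ) : ℂ) • eta ε q N := by
  simp only [gam, smul_add, smul_assoc, smul_comm (x q _) (_ : ℂ) (_ : Gam ε q N), Ct_add,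
    Ct_smul, Ct_x_x_smul, ← eta_eq]
  push_cast
  module

variable {ε} (hq1 : q ≠ 1) (hN : 3 ≤ N) (hε : ε = 1 ∨ ε = -1)
include hq hq1 hN hε

theorem linearRelations_plus : LinearRelations (fun i : Fin N => gam ε q (alphaPlus ε q N) i)
      (fun k l i j => ε * R q k l i j) := by
  intro i j
  beta_reduce
  rw [sum_mul_smul]
  change _ = (ε : ℂ) • Rop q (fun k l => x q k • gam ε q (alphaPlus ε q N) l) i j
  rw [gam_smul hq, Rop_gam]
  obtain ⟨Q, D, hQ, hd, hD, -, hc, h1, h2, hp, -⟩ := const_forms hq hq1 hN hε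
  have e1 : ε * q - 1 - ε * lam q + alphaPlus ε q N * (ε * (cK q N - lam q) + ε * q - 1) = 0 := by
    rw [hp, hc, lam]; rcases hε with rfl | rfl <;> field_simp <;> rw [hD] <;> ring
  have e2 : coefK ε q N + ε * lam q = ε * (alphaPlus ε q N * (cK q N - lam q)) := by
    rw [hp, hc, h1, lam]; rcases hε with rfl | rfl <;> field_simp <;> rw [hD] <;> ring
  have e3 : coefC ε q N + alphaPlus ε q N * (ε * q + coefK ε q N + coefC ε q N) =
      ε * (alphaPlus ε q N * q) := by
    rw [hp, h1, h2, lam]; rcases hε with rfl | rfl <;> field_simp <;> rw [hD] <;> ring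
  rw [e1, e2, e3]
  generalize x q i • dx ε q j = v1
  generalize x q i • x q j • eta ε q N = v2
  push_cast
  module

theorem linearRelations_minus : LinearRelations (fun i : Fin N => gam ε q (alphaMinus ε q N) i)
      (fun k l i j => ε * Rinv q k l i j) := by
  intro i j
  beta_reduce
  rw [sum_mul_smul]
  change _ = (ε : ℂ) • Riop q (fun k l => x q k • gam ε q (alphaMinus ε q N) l) i j
  rw [gam_smul hq, Riop_eq, Rop_gam, Ct_gam]
  obtain ⟨Q, D, hQ, hd, hD, -, hc, h1, h2, -, hp⟩ := const_forms hq hq1 hN hε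
  have e1 : ε * q - 1 - ε * lam q + alphaMinus ε q N * (ε * (cK q N - lam q) + ε * q - 1) =
      - (ε * lam q) := by
    rw [hp, hc, lam]; rcases hε with rfl | rfl <;> field_simp <;> rw [hD] <;> ring
  have e2 : coefK ε q N + ε * lam q = ε * (alphaMinus ε q N * (cK q N - lam q)) +
      ε * lam q * (1 + alphaMinus ε q N) := by
    rw [hp, hc, h1, lam]; rcases hε with rfl | rfl <;> field_simp <;> rw [hD] <;> ring
  have e3 : coefC ε q N + alphaMinus ε q N * (ε * q + coefK ε q N + coefC ε q N) =
      ε * (alphaMinus ε q N * q) - ε * lam q * alphaMinus ε q N := by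
    rw [hp, h1, h2, lam]; rcases hε with rfl | rfl <;> field_simp <;> rw [hD] <;> ring
  rw [e1, e2, e3]
  simp only [gam, smul_add, smul_assoc, smul_comm (x q _) (_ : ℂ) (_ : Gam ε q N)]
  generalize x q i • dx ε q j = v1
  generalize x q i • x q j • eta ε q N = v2
  push_cast
  module

end calc1

end operators

/-! ### Right multiplication on the free module -/

section model
variable (ε q : ℝ) (N : ℕ)

/-- The free left module with basis `e_i`, in which the calculus is realized so that `γ⁺_i ↦ e_i`.
-/
abbrev FreeForms : Type := Fin N → Sphere q N

variable {N}
/-- The basis vectors of the free module. -/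
def e (i : Fin N) : FreeForms q N := Pi.single i 1

/-- The right multiplication by `x_j` on the free module: the left linear map with
`e_i x_j = ε R̂^{kl}_{ij} x_k e_l`. -/
def rightMul (j : Fin N) : FreeForms q N →ₗ[Sphere q N] FreeForms q N :=
  Fintype.linearCombination (Sphere q N)
    fun i => (ε : ℂ) • Rop q (fun k l => x q k • e q l) i j

variable {q}

theorem rightMul_e (i j : Fin N) :
    rightMul ε q j (e q i) = (ε : ℂ) • Rop q (fun k l => x q k • e q l) i j := by
  rw [rightMul, e, Fintype.linearCombination_apply_single, one_smul]

theorem linearMap_Rop {M M' : Type*} [AddCommGroup M] [Module ℂ M]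
    [Module (Sphere q N) M] [IsScalarTower ℂ (Sphere q N) M] [AddCommGroup M'] [Module ℂ M']
    [Module (Sphere q N) M'] [IsScalarTower ℂ (Sphere q N) M'] (f : M →ₗ[Sphere q N] M')
    (G : Fin N → Fin N → M) (i j : Fin N) :
    f (Rop q G i j) = Rop q (fun k l => f (G k l)) i j :=
  map_Rop q G (f.restrictScalars ℂ) i j

theorem linearMap_Ct {M M' : Type*} [AddCommGroup M] [Module ℂ M]
    [Module (Sphere q N) M] [IsScalarTower ℂ (Sphere q N) M] [AddCommGroup M'] [Module ℂ M']
    [Module (Sphere q N) M'] [IsScalarTower ℂ (Sphere q N) M'] (f : M →ₗ[Sphere q N] M')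
    (G : Fin N → Fin N → M) :
    f (Ct q G) = Ct q (fun k l => f (G k l)) :=
  map_Ct q G (f.restrictScalars ℂ)

theorem linearMap_smul {M M' : Type*} [AddCommGroup M] [Module ℂ M]
    [Module (Sphere q N) M] [IsScalarTower ℂ (Sphere q N) M] [AddCommGroup M'] [Module ℂ M']
    [Module (Sphere q N) M'] [IsScalarTower ℂ (Sphere q N) M'] (f : M →ₗ[Sphere q N] M')
    (c : ℂ) (v : M) : f (c • v) = c • f v :=
  (f.restrictScalars ℂ).map_smul c v

variable {ε} (hq : 0 < q) (hε : ε = 1 ∨ ε = -1)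

include hq in
theorem lam_ne (hq1 : q ≠ 1) : (lam q : ℂ) ≠ 0 := by
  have h : lam q ≠ 0 := by
    intro h
    have h2 : q ^ 2 = 1 := by
      rw [lam, sub_eq_zero, ← mul_eq_one_iff_eq_inv₀ hq.ne'] at h
      rw [sq, h]
    exact hq1 ((pow_eq_one_iff_of_nonneg hq.le two_ne_zero).1 h2)
  exact_mod_cast h

include hε in
theorem eps_sq : (ε : ℂ) * ε = 1 := by rcases hε with rfl | rfl <;> simp

include hε in
/-- The product `e_a x_k x_l` as the action of `R̂` on the last two and then the first two of three
indices. The sign disappears because `ε² = 1`. -/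
theorem rightMul_rightMul_e (a k l : Fin N) : rightMul ε q l (rightMul ε q k (e q a)) =
    Rop q (fun k l' => Rop q (fun p n => x q k • x q p • e q n) l' l) a k := by
  rw [rightMul_e, linearMap_smul, linearMap_Rop]
  simp only [map_smul, rightMul_e]
  simp only [smul_comm (x q _) (_ : ℂ) (_ : FreeForms q N), Rop_smul,
    smul_smul _ _ (_ : FreeForms q N),
    eps_sq hε, one_smul, smul_Rop]

include hq hε

/-- The right multiplications satisfy the commutation relations of the sphere: by the Yang-Baxter
equation, `R̂` applied to `e_a x_k x_l` amounts to `R̂` applied to the product of the generators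
before it is moved to the left of the basis vector. -/
theorem Rop_rightMul (hq1 : q ≠ 1) (a i j : Fin N) :
    Rop q (fun k l => rightMul ε q l (rightMul ε q k (e q a))) i j =
      (q : ℂ) • rightMul ε q j (rightMul ε q i (e q a)) +
      ((cK q N - lam q : ℝ) : ℂ) • (C q i j : ℂ) • e q a := by
  have hl := lam_ne hq hq1
  have h : ∀ (b c : Fin N) (v : FreeForms q N), (C q b c : ℂ) • v =
      ((lam q : ℂ) * (C q b c : ℂ)) • (lam q : ℂ)⁻¹ • v := fun b c v => by
    rw [smul_smul, mul_right_comm, mul_inv_cancel₀ hl, one_mul]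
  simp only [rightMul_rightMul_e hε]
  rw [← yang_baxter hq N (fun k p n => x q k • x q p • e q n)]
  simp only [Rop_x_x_smul, Rop_add, Rop_smul, h]
  rw [Rop_Rop_C_slide hq N (fun c => (lam q : ℂ)⁻¹ • e q c)]

/-- The right multiplications satisfy the radius relation. -/
theorem Ct_rightMul (a : Fin N) :
    Ct q (fun k l => rightMul ε q l (rightMul ε q k (e q a))) = e q a := by
  simp only [rightMul_rightMul_e hε]
  rw [Ct_Rop_Rop_slide_symm hq N (fun k p n => x q k • x q p • e q n), Ct_x_x_smul]

omit hq hε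
variable (ε q N) in
/-- The image of `η` in the free module. The factor comes from `C^{kl} x_k γ⁺_l = (1 + α⁺) η`. -/
def etaModel : FreeForms q N :=
  ((1 + alphaPlus ε q N : ℝ) : ℂ)⁻¹ • Ct q (fun k l : Fin N => x q k • e q l)

variable (ε q) in
/-- The image of `dx_i` in the free module, obtained by solving `γ⁺_i = dx_i + α⁺ x_i η` for
`dx_i`. -/
def dModel (i : Fin N) : FreeForms q N := e q i - (alphaPlus ε q N : ℂ) • x q i • etaModel ε q N

include hε hq

variable (hq1 : q ≠ 1) (hN : 3 ≤ N)
include hq1 hN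

theorem one_add_alphaPlus_ne : 1 + alphaPlus ε q N ≠ 0 := by
  obtain ⟨Q, D, hQ, hd, hD, -, -, -, -, hp, -⟩ := const_forms hq hq1 hN hε
  have h := one_add_eps_mul_ne hq hq1 hε
  have : 1 + alphaPlus ε q N = -(Q * (1 + ε * q)) / D := by
    rw [hp]; field_simp; rw [hD]; ring
  rw [this]
  exact div_ne_zero (neg_ne_zero.2 (mul_ne_zero hQ.ne' h)) hd

theorem one_add_alphaMinus_ne : 1 + alphaMinus ε q N ≠ 0 := by
  obtain ⟨Q, D, hQ, hd, hD, -, -, -, -, -, hp⟩ := const_forms hq hq1 hN hε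
  have h := one_add_eps_mul_ne hq hq1 hε
  have : 1 + alphaMinus ε q N = (1 + ε * q) / D := by
    rw [hp]; field_simp; rw [hD]; ring
  rw [this]
  exact div_ne_zero h hd

theorem alphaPlus_ne_alphaMinus : alphaPlus ε q N ≠ alphaMinus ε q N := by
  obtain ⟨Q, D, hQ, hd, hD, -, -, -, -, hp, hm⟩ := const_forms hq hq1 hN hε
  have h := one_add_eps_mul_ne hq hq1 hε
  intro h'
  have : alphaMinus ε q N - alphaPlus ε q N = (1 + Q) * (1 + ε * q) / D := by
    rw [hp, hm]; ring
  rw [h', sub_self] at this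
  exact div_ne_zero (mul_ne_zero (by positivity) h) hd this.symm

theorem Ct_dModel : Ct q (fun k l : Fin N => x q k • dModel ε q l) = etaModel ε q N := by
  have h : ((1 + alphaPlus ε q N : ℝ) : ℂ) ≠ 0 := by
    exact_mod_cast one_add_alphaPlus_ne hq hε hq1 hN
  have h2 : Ct q (fun k l : Fin N => x q k • e q l) =
      ((1 + alphaPlus ε q N : ℝ) : ℂ) • etaModel ε q N := by
    rw [etaModel, smul_inv_smul₀ h]
  simp only [dModel, smul_sub, smul_comm (x q _) (_ : ℂ) (_ : FreeForms q N), Ct_sub, Ct_smul,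
    Ct_x_x_smul, h2]
  push_cast
  module

omit hε hq1 hN in
theorem rightMul_etaModel (j : Fin N) : rightMul ε q j (etaModel ε q N) =
    (ε : ℂ) • ((q : ℂ)⁻¹ • x q j • etaModel ε q N +
      (((1 + alphaPlus ε q N : ℝ) : ℂ)⁻¹ * (cK q N : ℂ)) • e q j) := by
  rw [etaModel, linearMap_smul, linearMap_Ct]
  simp only [map_smul, rightMul_e, smul_comm (x q _) (_ : ℂ) (_ : FreeForms q N), Ct_smul]
  rw [Ct_x_smul_Rop hq]
  generalize x q j • Ct q (fun k l : Fin N => x q k • e q l) = v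
  module

/-- The elements `dModel` satisfy the bimodule relations of `Γ_±`. -/
theorem rightMul_dModel (i j : Fin N) : rightMul ε q j (dModel ε q i) =
    (ε : ℂ) • Rop q (fun k l => x q k • dModel ε q l) i j +
    ((ε * q - 1 - ε * lam q : ℝ) : ℂ) • x q i • dModel ε q j +
    ((coefK ε q N + ε * lam q : ℝ) : ℂ) • (C q i j : ℂ) • etaModel ε q N +
    (coefC ε q N : ℂ) • x q i • x q j • etaModel ε q N := by
  have h1 : Rop q (fun k l => x q k • dModel ε q l) i j =
      Rop q (fun k l => x q k • e q l) i j -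
      (alphaPlus ε q N : ℂ) • ((q : ℂ) • x q i • x q j • etaModel ε q N +
        ((cK q N - lam q : ℝ) : ℂ) • (C q i j : ℂ) • etaModel ε q N) := by
    simp only [dModel, smul_sub, smul_comm (x q _) (_ : ℂ) (_ : FreeForms q N), Rop_sub, Rop_smul,
      Rop_x_x_smul]
  obtain ⟨Q, D, hQ, hd, hD, -, hc, hK, hC, hp, -⟩ := const_forms hq hq1 hN hε
  have hne := one_add_eps_mul_ne hq hq1 hε
  have hinv : (1 + alphaPlus ε q N)⁻¹ = - D / (Q * (1 + ε * q)) := by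
    have : 1 + alphaPlus ε q N = -(Q * (1 + ε * q)) / D := by
      rw [hp]; field_simp; rw [hD]; ring
    rw [this, inv_div, div_neg, neg_div]
  have e1 : - (alphaPlus ε q N * ε * ((1 + alphaPlus ε q N)⁻¹ * cK q N)) =
      ε * q - 1 - ε * lam q := by
    rw [hinv, hp, hc, lam]
    rcases hε with rfl | rfl
    · field_simp; ring
    · have : 1 - q ≠ 0 := fun h => hne (by linarith)
      rw [show (1 + -1 * q) = 1 - q by ring]; field_simp; ring
  have e2 : coefK ε q N + ε * lam q = ε * (alphaPlus ε q N * (cK q N - lam q)) := by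
    rw [hp, hc, hK, lam]; rcases hε with rfl | rfl <;> field_simp <;> rw [hD] <;> ring
  have e3 : coefC ε q N = ε * alphaPlus ε q N * q - alphaPlus ε q N * ε * q⁻¹ +
      (ε * q - 1 - ε * lam q) * alphaPlus ε q N := by
    rw [hp, hC, lam]; rcases hε with rfl | rfl <;> field_simp <;> ring
  rw [h1]
  nth_rw 1 [dModel]
  rw [map_sub, linearMap_smul, map_smul, rightMul_e, rightMul_etaModel hq, e2, e3, ← e1, dModel]
  simp only [smul_add, smul_sub, smul_comm (x q _) (_ : ℂ) (_ : FreeForms q N)]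
  generalize x q i • e q j = v1
  generalize x q i • x q j • etaModel ε q N = v2
  push_cast
  module

end model

/-! ### Pairs of a function and a one-form -/

section bimod
variable (ε q : ℝ) (N : ℕ)

/-- Pairs of a function and a one-form of the model. They become a bimodule in which the commutator
with `(1, 0)` is a derivation with values in the one-forms. -/
abbrev Pairs : Type := Sphere q N × FreeForms q N

variable {N}
/-- The right multiplication by `x_j` on pairs, `(a, v) x_j = (a x_j, a dx_j + v x_j)`. -/
def pairMul (j : Fin N) : Pairs q N →ₗ[Sphere q N] Pairs q N :=
  (LinearMap.toSpanSingleton (Sphere q N) (Pairs q N) (x q j, dModel ε q j)).coprod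
    ((LinearMap.inr (Sphere q N) (Sphere q N) (FreeForms q N)).comp (rightMul ε q j))

variable {q}
theorem pairMul_apply (j : Fin N) (a : Sphere q N) (v : FreeForms q N) :
    pairMul ε q j (a, v) = (a * x q j, a • dModel ε q j + rightMul ε q j v) := by
  simp [pairMul]

theorem pairs_ext {f g : Pairs q N →ₗ[Sphere q N] Pairs q N} (h1 : f (1, 0) = g (1, 0))
    (h2 : ∀ i, f (0, e q i) = g (0, e q i)) : f = g := by
  apply LinearMap.prod_ext
  · exact LinearMap.ext_ring h1
  · exact LinearMap.pi_ext' fun i => LinearMap.ext_ring (h2 i)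

theorem Rop_pair {V W : Type*} [AddCommGroup V] [Module ℂ V] [AddCommGroup W] [Module ℂ W]
    (G : Fin N → Fin N → V) (H : Fin N → Fin N → W) (i j : Fin N) :
    Rop q (fun k l => (G k l, H k l)) i j = (Rop q G i j, Rop q H i j) :=
  Prod.ext (map_Rop q (fun k l => (G k l, H k l)) (LinearMap.fst ℂ V W) i j)
    (map_Rop q (fun k l => (G k l, H k l)) (LinearMap.snd ℂ V W) i j)

theorem Ct_pair {V W : Type*} [AddCommGroup V] [Module ℂ V] [AddCommGroup W] [Module ℂ W]
    (G : Fin N → Fin N → V) (H : Fin N → Fin N → W) :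
    Ct q (fun k l => (G k l, H k l)) = (Ct q G, Ct q H) :=
  Prod.ext (map_Ct q (fun k l => (G k l, H k l)) (LinearMap.fst ℂ V W))
    (map_Ct q (fun k l => (G k l, H k l)) (LinearMap.snd ℂ V W))

variable {ε} (hq : 0 < q) (hε : ε = 1 ∨ ε = -1) (hq1 : q ≠ 1) (hN : 3 ≤ N)
include hε hq hq1 hN

/-- The expression for `d(x_i x_j) = x_i dx_j + dx_i x_j` in the model. -/
theorem leibniz (i j : Fin N) : x q i • dModel ε q j + rightMul ε q j (dModel ε q i) =
    (ε : ℂ) • Rop q (fun k l => x q k • dModel ε q l) i j +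
    ((ε * q⁻¹ : ℝ) : ℂ) • x q i • dModel ε q j +
    ((coefK ε q N + ε * lam q : ℝ) : ℂ) • (C q i j : ℂ) • etaModel ε q N +
    (coefC ε q N : ℂ) • x q i • x q j • etaModel ε q N := by
  rw [rightMul_dModel hq hε hq1 hN]
  generalize x q i • dModel ε q j = v1
  generalize x q i • x q j • etaModel ε q N = v2
  rw [lam]
  push_cast
  module

/-- The differentials of the commutation relations of the sphere vanish in the model. The term with
the unit does not contribute. -/
theorem Rop_leibniz (i j : Fin N) :
    Rop q (fun k l => x q k • dModel ε q l + rightMul ε q l (dModel ε q k)) i j =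
      (q : ℂ) • (x q i • dModel ε q j + rightMul ε q j (dModel ε q i)) := by
  have hq' : (q : ℂ) ≠ 0 := by exact_mod_cast hq.ne'
  have hC : Rop q (fun k l : Fin N => (C q k l : ℂ) • etaModel ε q N) i j =
      (q * ((hp q N : ℂ) ^ 2)⁻¹) • (C q i j : ℂ) • etaModel ε q N := by
    simpa only [one_mul] using Rop_C_smul hq 1 (etaModel ε q N) i j
  simp only [leibniz hq hε hq1 hN, Rop_add, Rop_smul, Rop_Rop hq, hC, Rop_x_x_smul,
    Ct_dModel hq hε hq1 hN]
  generalize x q i • dModel ε q j = v1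
  generalize x q i • x q j • etaModel ε q N = v2
  obtain ⟨Q, D, hQ, hd, hD, hs, hc, hK, hC, -, -⟩ := const_forms hq hq1 hN hε
  have key : -(ε * (q * (hp q N ^ 2)⁻¹) * lam q) +
      (coefK ε q N + ε * lam q) * (q * (hp q N ^ 2)⁻¹) + coefC ε q N * (cK q N - lam q) =
      q * (coefK ε q N + ε * lam q) := by
    rw [hs, hK, hC, hc, lam]
    rcases hε with rfl | rfl <;> field_simp <;> rw [hD] <;> ring
  have key' := congrArg (Complex.ofReal) key
  push_cast at key' ⊢
  linear_combination (norm := skip) key' • (C q i j : ℂ) • etaModel ε q N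
  simp only [lam]
  push_cast
  match_scalars <;> field_simp <;> ring

/-- The differential of the radius relation vanishes in the model. -/
theorem Ct_leibniz :
    Ct q (fun k l : Fin N => x q k • dModel ε q l + rightMul ε q l (dModel ε q k)) = 0 := by
  have hq' : (q : ℂ) ≠ 0 := by exact_mod_cast hq.ne'
  have hl := lam_ne hq hq1
  have hC : Ct q (fun k l : Fin N => (C q k l : ℂ) • etaModel ε q N) =
      (lam q : ℂ)⁻¹ • (lam q + (hp q N : ℂ) ^ 2 * (q : ℂ)⁻¹ - ((hp q N : ℂ) ^ 2)⁻¹ * q) •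
        etaModel ε q N := by
    have h := Ct_C_smul hq (N := N) ((lam q : ℂ)⁻¹ • etaModel ε q N)
    rw [smul_comm] at h
    rw [← h]
    refine congrArg _ (funext₂ fun k l => ?_)
    rw [smul_smul, mul_right_comm, mul_inv_cancel₀ hl, one_mul]
  simp only [leibniz hq hε hq1 hN, Ct_add, Ct_smul, Ct_Rop hq, hC, Ct_x_x_smul,
    Ct_dModel hq hε hq1 hN]
  obtain ⟨Q, D, hQ, hd, hD, hs, hc, hK, hC, -, -⟩ := const_forms hq hq1 hN hε
  have key : ε * (q * (hp q N ^ 2)⁻¹) + ε * q⁻¹ + (coefK ε q N + ε * lam q) *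
      ((lam q)⁻¹ * (lam q + hp q N ^ 2 * q⁻¹ - (hp q N ^ 2)⁻¹ * q)) + coefC ε q N = 0 := by
    have hl' : lam q ≠ 0 := by exact_mod_cast hl
    have hlq : lam q = (q ^ 2 - 1) / q := by rw [lam]; field_simp
    have hq2 : q ^ 2 - 1 ≠ 0 := fun h => hl' (by rw [hlq, h, zero_div])
    rw [hs, hK, hC, hlq]
    rcases hε with rfl | rfl <;> field_simp <;> rw [hD] <;> ring
  have key' := congrArg (Complex.ofReal) key
  push_cast at key' ⊢
  linear_combination (norm := module) key' • etaModel ε q N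

omit hε hq hq1 hN in
/-- The relations of the sphere may be checked after applying a jointly injective family of maps. -/
theorem isPoint_of_maps {B P ι : Type*} [Ring B] [Algebra ℂ B] [AddCommGroup P] [Module ℂ P]
    {y : Fin N → B} (φ : ι → B →ₗ[ℂ] P) (hφ : ∀ a b, (∀ s, φ s a = φ s b) → a = b)
    (h1 : ∀ s i j, Rop q (fun k l => φ s (y k * y l)) i j = (q : ℂ) • φ s (y i * y j) +
      ((cK q N - lam q : ℝ) : ℂ) • (C q i j : ℂ) • φ s 1)
    (h2 : ∀ s, Ct q (fun k l => φ s (y k * y l)) = φ s 1) : IsPoint q y := by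
  refine ⟨fun i j => hφ _ _ fun s => ?_, hφ _ _ fun s => ?_⟩
  · rw [map_Rop, h1, map_add, map_smul, map_smul, map_smul]
  · rw [map_Ct, h2]

/-- The right multiplications by the generators make the pairs a right module over the sphere. The
opposite algebra accounts for the order of the factors. -/
theorem isPoint_pairMul :
    IsPoint q (fun j : Fin N => MulOpposite.op (pairMul ε q j : Module.End (Sphere q N) (Pairs q
    N))) := by
  refine isPoint_of_maps (ι := Option (Fin N)) (P := Pairs q N)
    (fun s => { toFun := fun f => f.unop (s.elim (1, 0) fun a => (0, e q a))
                map_add' := fun _ _ => rfl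
                map_smul' := fun _ _ => rfl })
    (fun f g h => MulOpposite.unop_injective (pairs_ext (h none) fun a => h (some a))) ?_ ?_
  · rintro (_ | a) i j
    · simp only [LinearMap.coe_mk, AddHom.coe_mk, Option.elim, ← MulOpposite.op_mul,
        MulOpposite.unop_op, MulOpposite.unop_one, Module.End.one_apply,
        Module.End.mul_apply, pairMul_apply, one_mul, map_zero, add_zero, one_smul, Rop_pair,
        Rop_leibniz hq hε hq1 hN, (isPoint_x q N).1]
      simp [-Complex.coe_smul]
    · simp only [LinearMap.coe_mk, AddHom.coe_mk, Option.elim, ← MulOpposite.op_mul,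
        MulOpposite.unop_op, MulOpposite.unop_one, Module.End.one_apply,
        Module.End.mul_apply, pairMul_apply, zero_mul, zero_smul, zero_add, Rop_pair,
        Rop_rightMul hq hε hq1, Rop_zero_fun]
      simp [-Complex.coe_smul]
  · rintro (_ | a)
    · simp only [LinearMap.coe_mk, AddHom.coe_mk, Option.elim, ← MulOpposite.op_mul,
        MulOpposite.unop_op, MulOpposite.unop_one, Module.End.one_apply,
        Module.End.mul_apply, pairMul_apply, one_mul, map_zero, add_zero, one_smul, Ct_pair,
        Ct_leibniz hq hε hq1 hN, (isPoint_x q N).2]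
    · simp only [LinearMap.coe_mk, AddHom.coe_mk, Option.elim, ← MulOpposite.op_mul,
        MulOpposite.unop_op, MulOpposite.unop_one, Module.End.one_apply,
        Module.End.mul_apply, pairMul_apply, zero_mul, zero_smul, zero_add, Ct_pair,
        Ct_rightMul hq hε, Ct_zero_fun]

end bimod

/-! ### Realization of the calculus -/

section env
variable {ε q : ℝ} {N : ℕ} (hq : 0 < q) (hε : ε = 1 ∨ ε = -1) (hq1 : q ≠ 1) (hN : 3 ≤ N)

/-- The action of the enveloping algebra on a left module `P` whose right action is given by left
linear endomorphisms, that is by a homomorphism to the opposite of their algebra. -/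
def envAction {A P : Type*} [Ring A] [Algebra ℂ A] [AddCommGroup P] [Module ℂ P] [Module A P]
    [IsScalarTower ℂ A P] (ρ : A →ₐ[ℂ] (Module.End A P)ᵐᵒᵖ) : Env A →ₐ[ℂ] Module.End ℂ P :=
  Algebra.TensorProduct.lift (Algebra.lsmul ℂ ℂ P)
    ({ toFun := fun b => (ρ b.unop).unop.restrictScalars ℂ
       map_one' := by rw [MulOpposite.unop_one, map_one]; rfl
       map_mul' := fun a b => by rw [MulOpposite.unop_mul, map_mul]; rfl
       map_zero' := by rw [MulOpposite.unop_zero, map_zero]; rfl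
       map_add' := fun a b => by rw [MulOpposite.unop_add, map_add]; rfl
       commutes' := fun c => by
        rw [MulOpposite.algebraMap_apply, MulOpposite.unop_op, AlgHom.commutes]; rfl } :
      Aᵐᵒᵖ →ₐ[ℂ] Module.End ℂ P)
    fun a b => LinearMap.ext fun p => (map_smul (ρ b.unop).unop a p).symm

theorem envAction_left {A P : Type*} [Ring A] [Algebra ℂ A] [AddCommGroup P] [Module ℂ P]
    [Module A P] [IsScalarTower ℂ A P] (ρ : A →ₐ[ℂ] (Module.End A P)ᵐᵒᵖ) (a : A) (p : P) :
    envAction ρ (left a) p = a • p := by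
  refine (LinearMap.congr_fun (Algebra.TensorProduct.lift_tmul _ _ _ a (1 : Aᵐᵒᵖ)) p).trans ?_
  rw [map_one, mul_one]
  rfl

theorem envAction_right {A P : Type*} [Ring A] [Algebra ℂ A] [AddCommGroup P] [Module ℂ P]
    [Module A P] [IsScalarTower ℂ A P] (ρ : A →ₐ[ℂ] (Module.End A P)ᵐᵒᵖ) (b : Aᵐᵒᵖ) (p : P) :
    envAction ρ (right b) p = (ρ b.unop).unop p := by
  refine (LinearMap.congr_fun (Algebra.TensorProduct.lift_tmul _ _ _ (1 : A) b) p).trans ?_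
  rw [map_one, one_mul]
  rfl

include hq hε hq1 hN

/-- The calculus maps to the pairs by `d a ↦ (1, 0) a - a (1, 0)`. The image consists of pairs with
first component `0`. -/
theorem exists_toPairs : ∃ Φ : Gam ε q N →ₗ[Sphere q N] Pairs q N,
    (∀ i, Φ (dx ε q i) = (0, dModel ε q i)) ∧ ∀ ω j, Φ (ω <• x q j) = pairMul ε q j (Φ ω) := by
  let ρ := Sphere.lift (isPoint_pairMul hq hε hq1 hN)
  have hρ : ∀ j, (ρ (x q j)).unop = pairMul ε q j := fun j => by
    rw [Sphere.lift_x]; rfl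
  let _ : Module (Env (Sphere q N)) (Pairs q N) :=
    Module.compHom (Pairs q N) (envAction ρ).toRingHom
  have hleft : ∀ (a : Sphere q N) (p : Pairs q N), left a • p = a • p := envAction_left ρ
  have hright : ∀ (j : Fin N) (p : Pairs q N),
      right (MulOpposite.op (x q j)) • p = pairMul ε q j p := fun j p => by
    rw [← hρ]; exact envAction_right ρ _ p
  -- The universal one-forms lie in the enveloping algebra, which acts on the pair `(1, 0)`.
  let φ : univForms (Sphere q N) →ₗ[Env (Sphere q N)] Pairs q N :=
    (LinearMap.toSpanSingleton (Env (Sphere q N)) (Pairs q N) (1, 0)).comp (Submodule.subtype _)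
  have hφD : ∀ i : Fin N, φ (univD (x q i)) = (0, dModel ε q i) := fun i => by
    change preD (x q i) • ((1, 0) : Pairs q N) = _
    rw [preD, sub_smul, hleft, hright, pairMul_apply]
    simp
  have hker : Submodule.span (Env (Sphere q N)) (relations ε q N) ≤ LinearMap.ker φ := by
    rw [Submodule.span_le]
    rintro _ ⟨⟨i, j⟩, rfl⟩
    have hl : ∀ (a : Sphere q N) (l : Fin N), φ (lmulD a (x q l)) =
        LinearMap.inr (Sphere q N) (Sphere q N) (FreeForms q N) (a • dModel ε q l) := fun a l => by
      rw [lmulD, map_smul, hφD, hleft]; simp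
    have hr : φ (rmulD (x q i) (x q j)) =
        LinearMap.inr (Sphere q N) (Sphere q N) (FreeForms q N)
          (rightMul ε q j (dModel ε q i)) := by
      rw [rmulD, map_smul, hφD, hright, pairMul_apply]; simp
    rw [SetLike.mem_coe, LinearMap.mem_ker, map_sub, sub_eq_zero, hr,
      rightMul_dModel hq hε hq1 hN, ← bimodule_sum_eq ε _ (Ct_dModel hq hε hq1 hN)]
    simp only [bimoduleRHS, map_add, map_sum, hl]
  let Φ : Forms (Sphere q N) (relations ε q N) →ₗ[Env (Sphere q N)] Pairs q N :=
    Submodule.liftQ _ φ hker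
  refine ⟨{ toFun := Φ, map_add' := map_add Φ, map_smul' := fun a ω => ?_ }, hφD, fun ω j => ?_⟩
  · rw [left_smul_def, map_smul, hleft]; rfl
  · change Φ _ = _
    rw [right_smul_def, map_smul, hright]; rfl

end env

/-! ### The bases -/

section basis
variable {ε q : ℝ} {N : ℕ}

theorem d_algebraMap {A : Type*} [Ring A] [Algebra ℂ A] (S : Set (univForms A)) (c : ℂ) :
    d S (algebraMap ℂ A c) = 0 := by
  have h1 : d S (1 : A) = 0 := by
    have h := d_mul S (1 : A) 1
    rw [mul_one, MulOpposite.op_one, one_smul, one_smul] at h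
    exact left_eq_add.1 h
  rw [Algebra.algebraMap_eq_smul_one, map_smul, h1, smul_zero]

theorem span_dx (ε q : ℝ) (N : ℕ) :
    Submodule.span (Sphere q N) (Set.range (dx ε q : Fin N → Gam ε q N)) = ⊤ := by
  set S := Submodule.span (Sphere q N) (Set.range (dx ε q : Fin N → Gam ε q N)) with hS
  have hdx : ∀ i : Fin N, dx ε q i ∈ S := fun i => Submodule.subset_span ⟨i, rfl⟩
  have hright : ∀ b : Sphere q N, ∀ ω ∈ S, ω <• b ∈ S := by
    intro b
    induction b using Sphere.induction with
    | scalar c =>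
      intro ω hω
      have h : ω <• algebraMap ℂ (Sphere q N) c = algebraMap ℂ (Sphere q N) c • ω := by
        rw [← MulOpposite.algebraMap_apply, algebraMap_smul, algebraMap_smul]
      rw [h]
      exact S.smul_mem _ hω
    | gen j =>
      intro ω hω
      induction hω using Submodule.span_induction with
      | zero => rw [smul_zero]; exact S.zero_mem
      | add v w _ _ hv hw => rw [smul_add]; exact S.add_mem hv hw
      | smul a v _ hv => rw [← smul_comm]; exact S.smul_mem _ hv
      | mem v hv =>
        obtain ⟨i, rfl⟩ := hv
        rw [dx_mul_x]
        refine S.add_mem (S.add_mem (S.add_mem ?_ ?_) ?_) ?_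
        · exact S.sum_mem fun _ _ => S.sum_mem fun _ _ => S.smul_mem _ (hdx _)
        · exact S.smul_mem _ (hdx _)
        · exact S.sum_mem fun _ _ => S.sum_mem fun _ _ => S.smul_mem _ (hdx _)
        · exact S.sum_mem fun _ _ => S.sum_mem fun _ _ => S.smul_mem _ (hdx _)
    | mul a b ha hb =>
      intro ω hω
      rw [MulOpposite.op_mul, mul_smul]
      exact hb _ (ha _ hω)
    | add a b ha hb =>
      intro ω hω
      rw [MulOpposite.op_add, add_smul]
      exact S.add_mem (ha _ hω) (hb _ hω)
  rw [eq_top_iff, ← span_range_d, Submodule.span_le]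
  rintro _ ⟨a, rfl⟩
  induction a using Sphere.induction with
  | scalar c => rw [d_algebraMap]; exact S.zero_mem
  | gen i => exact hdx i
  | mul a b ha hb => rw [d_mul]; exact S.add_mem (hright _ _ ha) (S.smul_mem _ hb)
  | add a b ha hb => rw [map_add]; exact S.add_mem ha hb

theorem span_gam {α : ℝ} (hα : 1 + α ≠ 0) :
    Submodule.span (Sphere q N) (Set.range (fun i : Fin N => gam ε q α i)) = ⊤ := by
  set S := Submodule.span (Sphere q N) (Set.range (fun i : Fin N => gam ε q α i)) with hS
  have hC : ∀ (c : ℂ), ∀ ω ∈ S, c • ω ∈ S := fun c ω hω => by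
    rw [← algebraMap_smul (Sphere q N) c ω]; exact S.smul_mem _ hω
  have hg : ∀ i : Fin N, gam ε q α i ∈ S := fun i => Submodule.subset_span ⟨i, rfl⟩
  have heta : eta ε q N ∈ S := by
    have h : ((1 + α : ℝ) : ℂ) ≠ 0 := by exact_mod_cast hα
    rw [← inv_smul_smul₀ h (eta ε q N), ← Ct_gam]
    exact hC _ _ (S.sum_mem fun _ _ => S.sum_mem fun _ _ => hC _ _ (S.smul_mem _ (hg _)))
  rw [eq_top_iff, ← span_dx, Submodule.span_le]
  rintro _ ⟨i, rfl⟩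
  have h : dx ε q i = gam ε q α i - ((α : ℂ) • x q i) • eta ε q N := by
    rw [gam, add_sub_cancel_right]
  rw [h]
  exact S.sub_mem (hg i) (S.smul_mem _ heta)

variable (hq : 0 < q) (hε : ε = 1 ∨ ε = -1) (hq1 : q ≠ 1) (hN : 3 ≤ N)
include hq hε hq1 hN

theorem toPairs_gam {Φ : Gam ε q N →ₗ[Sphere q N] Pairs q N}
    (hΦ : ∀ i, Φ (dx ε q i) = (0, dModel ε q i)) (α : ℝ) (i : Fin N) :
    Φ (gam ε q α i) =
      (0, e q i + ((α - alphaPlus ε q N : ℝ) : ℂ) • x q i • etaModel ε q N) := by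
  have heta : Φ (eta ε q N) = (0, etaModel ε q N) := by
    rw [eta_eq, linearMap_Ct, ← Ct_dModel hq hε hq1 hN]
    simp only [map_smul, hΦ, Prod.smul_mk, smul_zero, Ct_pair, Ct_zero_fun]
  rw [gam, map_add, map_smul, hΦ, heta, dModel, smul_assoc]
  simp only [Prod.smul_mk, Prod.mk_add_mk, smul_zero, add_zero]
  congr 1
  generalize x q i • etaModel ε q N = v
  push_cast
  module

theorem linearIndependent_gam {α : ℝ} (hα : 1 + α ≠ 0) :
    LinearIndependent (Sphere q N) (fun i : Fin N => gam ε q α i) := by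
  obtain ⟨Φ, hΦ, -⟩ := exists_toPairs hq hε hq1 hN
  rw [Fintype.linearIndependent_iff]
  intro a ha
  have hp : ((1 + alphaPlus ε q N : ℝ) : ℂ) ≠ 0 := by
    exact_mod_cast one_add_alphaPlus_ne hq hε hq1 hN
  have h1 : ∑ i, a i • (e q i + ((α - alphaPlus ε q N : ℝ) : ℂ) • x q i • etaModel ε q N) = 0 := by
    have h := congrArg (fun ω => (Φ ω).2) ha
    simpa only [map_sum, map_smul, toPairs_gam hq hε hq1 hN hΦ, Prod.snd_sum, Prod.smul_snd,
      map_zero, Prod.snd_zero] using h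
  -- The functional `e_i ↦ x_i` maps `η` to a scalar, and hence the image of `γ_i` to a multiple
  -- of `x_i`. The factor is `(1 + α) / (1 + α⁺)`.
  let ℓ : FreeForms q N →ₗ[Sphere q N] Sphere q N :=
    Fintype.linearCombination (Sphere q N) (fun i => x q i)
  have hℓe : ∀ i, ℓ (e q i) = x q i := fun i => by
    change Fintype.linearCombination (Sphere q N) (fun i => x q i) (Pi.single i 1) = x q i
    rw [Fintype.linearCombination_apply_single, one_smul]
  have hℓη : ℓ (etaModel ε q N) = ((1 + alphaPlus ε q N : ℝ) : ℂ)⁻¹ • (1 : Sphere q N) := by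
    rw [etaModel, linearMap_smul, linearMap_Ct]
    simp only [map_smul, hℓe, smul_eq_mul, (isPoint_x q N).2]
  have h2 : ∑ i, a i • x q i = 0 := by
    have h := congrArg ℓ h1
    simp only [map_sum, map_smul, map_add, linearMap_smul, hℓe, hℓη, map_zero, smul_add,
      Finset.sum_add_distrib] at h
    have h3 : ∑ i, a i • ((α - alphaPlus ε q N : ℝ) : ℂ) • x q i •
        ((1 + alphaPlus ε q N : ℝ) : ℂ)⁻¹ • (1 : Sphere q N) =
        (((α - alphaPlus ε q N : ℝ) : ℂ) * ((1 + alphaPlus ε q N : ℝ) : ℂ)⁻¹) •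
          ∑ i, a i • x q i := by
      rw [Finset.smul_sum]
      refine Finset.sum_congr rfl fun i _ => ?_
      simp only [smul_eq_mul, mul_smul_comm, mul_one, smul_smul]
    have h4 : (1 + ((α - alphaPlus ε q N : ℝ) : ℂ) * ((1 + alphaPlus ε q N : ℝ) : ℂ)⁻¹) •
        ∑ i, a i • x q i = 0 := by
      rw [add_smul, one_smul, ← h3]; exact h
    refine (smul_eq_zero.1 h4).resolve_left ?_
    have h5 : (1 + ((α - alphaPlus ε q N : ℝ) : ℂ) * ((1 + alphaPlus ε q N : ℝ) : ℂ)⁻¹) =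
        ((1 + α : ℝ) : ℂ) * ((1 + alphaPlus ε q N : ℝ) : ℂ)⁻¹ := by
      field_simp; push_cast; ring
    rw [h5]
    exact mul_ne_zero (by exact_mod_cast hα) (inv_ne_zero hp)
  have h6 : ∑ i, a i • e q i = 0 := by
    have h7 : ∑ i, a i • ((α - alphaPlus ε q N : ℝ) : ℂ) • x q i • etaModel ε q N = 0 := by
      simp only [smul_comm (a _) (_ : ℂ) (_ : FreeForms q N), ← mul_smul (a _), ← Finset.smul_sum,
        ← Finset.sum_smul]
      simp only [smul_eq_mul] at h2
      rw [h2, zero_smul, smul_zero]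
    simpa only [smul_add, Finset.sum_add_distrib, h7, add_zero] using h1
  intro i
  have h8 := congrFun h6 i
  simpa [e, Finset.sum_apply, Pi.single_apply] using h8

theorem isLeftBasis_gam {α : ℝ} (hα : 1 + α ≠ 0) :
    IsLeftBasis (fun i : Fin N => gam ε q α i) :=
  ⟨linearIndependent_gam hq hε hq1 hN hα, span_gam hα⟩

end basis

/-! ### Uniqueness of the two values -/

section characters
variable {q : ℝ} {n : ℕ} (hq : 0 < q)

/-- The values on the generators of the character of the sphere with parameter `t`. The value at the
last generator is determined by the radius relation. -/
def torusPoint (q : ℝ) (n : ℕ) (t : ℂ) (a : Fin (n + 2)) : ℂ :=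
  if a = 0 then t else if a = Fin.last (n + 1) then hp q n / (hp q n ^ 2 + 1) * t⁻¹ else 0

@[simp] theorem torusPoint_zero (t : ℂ) : torusPoint q n t 0 = t := by simp [torusPoint]
@[simp] theorem torusPoint_mid (t : ℂ) (i : Fin n) : torusPoint q n t (mid i) = 0 := by
  simp [torusPoint]
@[simp] theorem torusPoint_last (t : ℂ) :
    torusPoint q n t (Fin.last (n + 1)) = hp q n / (hp q n ^ 2 + 1) * t⁻¹ := by simp [torusPoint]

include hq in
theorem cK_sub_lam : cK q (n + 2) - lam q = - lam q / (hp q n ^ 2 + 1) := by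
  have h := hp_sq' hq (n + 2)
  rw [hp_add_two hq, mul_pow] at h
  have h2 : hp q n ^ 2 = q ^ (((n + 2 : ℕ) : ℤ) - 2) :=
    mul_right_cancel₀ (pow_ne_zero 2 hq.ne') h
  obtain ⟨-, h3, h4⟩ := zpows hq (n + 2)
  have := hp_pos hq n
  rw [cK, h3, h4, ← h2, lam]
  field_simp
  ring

include hq in
theorem isPoint_torusPoint {t : ℂ} (ht : t ≠ 0) : IsPoint q (torusPoint q n t) := by
  have hq' : (q : ℂ) ≠ 0 := by exact_mod_cast hq.ne'
  have he : ∀ a b : Fin (n + 2), e q a b = if b = a then 1 else 0 := fun a b => by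
    rw [e, Pi.single_apply]
  have hs : (hp q n : ℂ) ≠ 0 := by exact_mod_cast (hp_pos hq n).ne'
  have hs2 : (hp q n : ℂ) ^ 2 + 1 ≠ 0 := by
    have : hp q n ^ 2 + 1 ≠ 0 := by positivity
    exact_mod_cast this
  refine ⟨fun i j => ?_, ?_⟩
  · rw [cK_sub_lam hq]
    rcases ends_cases i with rfl | ⟨i, rfl⟩ | rfl <;>
    rcases ends_cases j with rfl | ⟨j, rfl⟩ | rfl <;>
      simp only [Rop_zero_zero, Rop_zero_mid, Rop_mid_zero, Rop_mid_last, Rop_last_mid,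
        Rop_last_last, Rop_last_zero, Rop_zero_last hq, Rop_mid_mid hq, C_mid_mid,
        C_zero_last q hq, C_last_zero, C_zero_zero, C_zero_mid, C_mid_zero, C_last_last,
        C_last_mid, C_mid_last, torusPoint_zero, torusPoint_mid, torusPoint_last, mul_zero,
        zero_mul, add_zero, Complex.ofReal_zero, Rop_zero_fun,
        Ct_zero_fun, zero_add, smul_eq_mul, mul_one, lam]
    all_goals push_cast
    all_goals field_simp
    all_goals ring
  · rw [Ct_ends hq]
    simp only [torusPoint_zero, torusPoint_mid, torusPoint_last, mul_zero, Ct_zero_fun,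
      smul_eq_mul]
    field_simp
    ring

/-- The leading coefficient of a Laurent polynomial which vanishes at `t = 1, 2, 4` is zero if its
exponents are `3`, `1` and `-1`. -/
theorem coeff_eq_zero {a b c : ℂ} (h : ∀ t : ℂ, t ≠ 0 → a * t ^ 3 + b * t + c * t⁻¹ = 0) :
    a = 0 := by
  have h1 := h 1 one_ne_zero
  have h2 := h 2 two_ne_zero
  have h3 := h 4 (by norm_num)
  norm_num at h1 h2 h3
  linear_combination (1 / 45 : ℂ) * h3 - (1 / 9 : ℂ) * h2 * (1 / 2 : ℂ) + (1 / 45 : ℂ) * h1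

/-- The same with the exponents `1`, `-1` and `-3`. -/
theorem coeff_eq_zero' {a b c : ℂ} (h : ∀ t : ℂ, t ≠ 0 → a * t + b * t⁻¹ + c * (t⁻¹) ^ 3 = 0) :
    a = 0 := by
  have h1 := h 1 one_ne_zero
  have h2 := h 2 two_ne_zero
  have h3 := h 4 (by norm_num)
  norm_num at h1 h2 h3
  linear_combination (16 / 45 : ℂ) * h3 - (2 / 9 : ℂ) * h2 + (1 / 45 : ℂ) * h1

end characters

section unique
variable {ε q : ℝ} {N : ℕ} (hq : 0 < q) (hε : ε = 1 ∨ ε = -1) (hq1 : q ≠ 1) (hN : 3 ≤ N)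
include hq hε hq1 hN

/-- The relation for `γ_1 x_1` alone forces `α` to be one of the two values. -/
theorem eq_of_linearRelations {α : ℝ} {A : Fin N → Fin N → Fin N → Fin N → ℝ}
    (hA : LinearRelations (fun i : Fin N => gam ε q α i) A) :
    α = alphaPlus ε q N ∨ α = alphaMinus ε q N := by
  obtain ⟨Φ, hΦ, hΦr⟩ := exists_toPairs hq hε hq1 hN
  obtain ⟨n, rfl⟩ : ∃ n, N = n + 2 := ⟨N - 2, by omega⟩
  set τ : ℝ := α - alphaPlus ε q (n + 2) with hτ
  set κ : ℂ := ((1 + alphaPlus ε q (n + 2) : ℝ) : ℂ)⁻¹ with hκ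
  -- the relation for `γ_1 x_1`, in the free module
  have h1 : ((ε * q : ℝ) : ℂ) • x q (0 : Fin (n + 2)) • e q (0 : Fin (n + 2)) +
      ((τ * ε : ℝ) : ℂ) • x q (0 : Fin (n + 2)) •
        ((q : ℂ)⁻¹ • x q (0 : Fin (n + 2)) • etaModel ε q (n + 2) +
        (κ * (cK q (n + 2) : ℂ)) • e q (0 : Fin (n + 2))) =
      ∑ k, ∑ l, (A k l 0 0 : ℂ) • x q k •
        (e q l + (τ : ℂ) • x q l • etaModel ε q (n + 2)) := by
    have h := congrArg (fun ω => (Φ ω).2) (hA 0 0)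
    simp only [hΦr, map_sum, smul_assoc, linearMap_smul, map_smul,
      toPairs_gam hq hε hq1 hN hΦ, Prod.snd_sum, Prod.smul_snd, pairMul_apply, zero_smul,
      zero_add, map_add, rightMul_e, rightMul_etaModel hq, Rop_zero_zero] at h
    rw [← h]
    simp only [← hκ, ← hτ, smul_add, smul_comm (x q _) (_ : ℂ) (_ : FreeForms q (n + 2))]
    generalize x q (0 : Fin (n + 2)) • e q (0 : Fin (n + 2)) = v1
    generalize x q (0 : Fin (n + 2)) • x q (0 : Fin (n + 2)) • etaModel ε q (n + 2) = v2
    push_cast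
    module
  by_cases hτ0 : τ = 0
  · left; linarith
  right
  have hηn : ∀ m, etaModel ε q (n + 2) m = κ • ∑ k, (C q k m : ℂ) • x q k := fun m => by
    rw [etaModel, Pi.smul_apply, ← hκ, Ct]
    simp only [Finset.sum_apply, Pi.smul_apply, e, Pi.single_apply, smul_eq_mul, mul_ite, mul_one,
      mul_zero, smul_ite, smul_zero, Finset.sum_ite_eq, Finset.mem_univ, if_true]
  have he : ∀ a b : Fin (n + 2), e q a b = if b = a then 1 else 0 := fun a b => by
    rw [e, Pi.single_apply]
  have hs : (hp q n : ℂ) ≠ 0 := by exact_mod_cast (hp_pos hq n).ne'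
  set u : ℂ := (hp q n : ℂ) / ((hp q n : ℂ) ^ 2 + 1) with hu
  have hκ0 : κ ≠ 0 := by
    rw [hκ]; exact inv_ne_zero (by exact_mod_cast one_add_alphaPlus_ne hq hε hq1 hN)
  have hε0 : (ε : ℂ) ≠ 0 := by rcases hε with rfl | rfl <;> simp
  have hτ1 : (τ : ℂ) ≠ 0 := by exact_mod_cast hτ0
  clear_value u κ
  -- the component at the last index determines one coefficient of `A`
  have hA0 : (A 0 0 0 0 : ℂ) = ε * (q : ℂ)⁻¹ := by
    have hL : ((τ : ℂ) * κ * (hp q n : ℂ)⁻¹) * (ε * (q : ℂ)⁻¹ - A 0 0 0 0) = 0 := by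
      refine coeff_eq_zero
        (b := -(A 0 (Fin.last _) 0 0 * (1 + τ * u * κ * (hp q n : ℂ)⁻¹) +
          A (Fin.last _) 0 0 0 * u * τ * κ * (hp q n : ℂ)⁻¹))
        (c := -(A (Fin.last _) (Fin.last _) 0 0 * u * (1 + τ * u * κ * (hp q n : ℂ)⁻¹)))
        fun t ht => ?_
      have h := congrArg (Sphere.lift (isPoint_torusPoint (n := n) hq ht))
        (congrFun h1 (Fin.last _))
      simp only [Pi.add_apply, Pi.smul_apply, Finset.sum_apply, map_add, map_sum, map_smul,
        map_mul, smul_eq_mul, Sphere.lift_x, hηn, sum_ends, torusPoint_zero, torusPoint_mid,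
        torusPoint_last, smul_zero, zero_mul, mul_zero, Finset.sum_const_zero, add_zero,
        C_zero_last q hq, C_mid_last, C_last_last, Complex.ofReal_zero, zero_add, he, if_true,
        last_ne_zero', last_ne_mid, if_false, map_one, ← hu] at h
      push_cast at h
      have e1 : t * t⁻¹ = 1 := mul_inv_cancel₀ ht
      linear_combination h + (τ * u * κ * (hp q n : ℂ)⁻¹ * (A 0 (Fin.last _) 0 0 * t +
        A (Fin.last _) 0 0 0 * t + A (Fin.last _) (Fin.last _) 0 0 * u * t⁻¹)) * e1
    have h := (mul_eq_zero.1 hL).resolve_left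
      (mul_ne_zero (mul_ne_zero hτ1 hκ0) (inv_ne_zero hs))
    exact (sub_eq_zero.1 h).symm
  -- the component at the first index then determines `τ`
  have hτκ : (lam q : ℂ) + τ * κ * cK q (n + 2) = 0 := by
    have h0 : ε * q + τ * ε * ((q : ℂ)⁻¹ * κ * hp q n * u + κ * cK q (n + 2)) -
        A 0 0 0 0 * (1 + τ * κ * hp q n * u) = 0 := by
      refine coeff_eq_zero'
        (b := -(A 0 (Fin.last _) 0 0 * τ * κ * hp q n * u ^ 2 +
          A (Fin.last _) 0 0 0 * u * (1 + τ * κ * hp q n * u)))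
        (c := -(A (Fin.last _) (Fin.last _) 0 0 * τ * κ * hp q n * u ^ 3)) fun t ht => ?_
      have h := congrArg (Sphere.lift (isPoint_torusPoint (n := n) hq ht)) (congrFun h1 0)
      simp only [Pi.add_apply, Pi.smul_apply, Finset.sum_apply, map_add, map_sum, map_smul,
        map_mul, smul_eq_mul, Sphere.lift_x, hηn, sum_ends, torusPoint_zero, torusPoint_mid,
        torusPoint_last, zero_mul, mul_zero, Finset.sum_const_zero, add_zero, C_zero_zero,
        C_mid_zero, C_last_zero, Complex.ofReal_zero, zero_add, he, if_true, zero_ne_mid,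
        zero_ne_last', if_false, map_one, mul_one, ← hu] at h
      push_cast at h
      have e1 : t * t⁻¹ = 1 := mul_inv_cancel₀ ht
      linear_combination h + (τ * κ * hp q n * u * (A 0 0 0 0 * t - ε * (q : ℂ)⁻¹ * t +
        A 0 (Fin.last _) 0 0 * u * t⁻¹ + A (Fin.last _) 0 0 0 * u * t⁻¹)) * e1
    rw [hA0] at h0
    have h2 : (ε : ℂ) * (lam q + τ * κ * cK q (n + 2)) = 0 := by
      rw [← h0, lam]; push_cast; ring
    exact (mul_eq_zero.1 h2).resolve_left hε0
  have hfin : lam q + τ * (1 + alphaPlus ε q (n + 2))⁻¹ * cK q (n + 2) = 0 := by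
    rw [hκ] at hτκ
    exact_mod_cast hτκ
  have hl : lam q ≠ 0 := by exact_mod_cast lam_ne hq hq1
  obtain ⟨Q, D, hQ, hd, hD, -, hc, -, -, hP, hM⟩ := const_forms hq hq1 hN hε
  have hE := one_add_eps_mul_ne hq hq1 hε
  have hinv : 1 + alphaPlus ε q (n + 2) = -(Q * (1 + ε * q)) / D := by
    rw [hP]; field_simp; rw [hD]; ring
  rw [hinv, hc] at hfin
  have hα : α = τ + alphaPlus ε q (n + 2) := by rw [hτ]; ring
  have hτ2 : τ = (1 + Q) * (1 + ε * q) / D := by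
    field_simp at hfin
    rw [mul_zero] at hfin
    have h := (mul_eq_zero.1 hfin).resolve_left hl
    field_simp
    linear_combination (-1 : ℝ) * h
  rw [hα, hτ2, hP, hM]
  ring

end unique

end

end QuantumSphere

theorem mainTheorem4 (N : ℕ) (hN : 3 ≤ N) (q : ℝ) (hq : 0 < q) (hq1 : q ≠ 1)
    (ε : ℝ) (hε : ε = 1 ∨ ε = -1) :
    {α : ℝ | QuantumSphere.IsLeftBasis (fun i : Fin N => QuantumSphere.gam ε q α i) ∧
        ∃ A : Fin N → Fin N → Fin N → Fin N → ℝ,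
          QuantumSphere.LinearRelations (fun i : Fin N => QuantumSphere.gam ε q α i) A} =
      {QuantumSphere.alphaPlus ε q N, QuantumSphere.alphaMinus ε q N} ∧
    QuantumSphere.alphaPlus ε q N ≠ QuantumSphere.alphaMinus ε q N ∧
    QuantumSphere.LinearRelations
      (fun i : Fin N => QuantumSphere.gam ε q (QuantumSphere.alphaPlus ε q N) i)
      (fun k l i j => ε * QuantumSphere.R q k l i j) ∧
    QuantumSphere.LinearRelations
      (fun i : Fin N => QuantumSphere.gam ε q (QuantumSphere.alphaMinus ε q N) i)
      (fun k l i j => ε * QuantumSphere.Rinv q k l i j) := by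
  have hlp := QuantumSphere.linearRelations_plus hq hq1 hN hε
  have hlm := QuantumSphere.linearRelations_minus hq hq1 hN hε
  refine ⟨Set.ext fun α => ⟨?_, ?_⟩, QuantumSphere.alphaPlus_ne_alphaMinus hq hε hq1 hN, hlp, hlm⟩
  · rintro ⟨-, A, hA⟩
    exact QuantumSphere.eq_of_linearRelations hq hε hq1 hN hA
  · rintro (rfl | rfl)
    · exact ⟨QuantumSphere.isLeftBasis_gam hq hε hq1 hN
        (QuantumSphere.one_add_alphaPlus_ne hq hε hq1 hN), _, hlp⟩
    · exact ⟨QuantumSphere.isLeftBasis_gam hq hε hq1 hN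
        (QuantumSphere.one_add_alphaMinus_ne hq hε hq1 hN), _, hlm⟩
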